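/- Let $k$ be a field and let $X$ be a smooth projective variety over $k$ (an integral scheme, smooth and projective over $k$). Let $D_1,\dots,D_r$ be effective divisors on $X$ whose classes form a $\mathbb{Z}$-basis of $\operatorname{Pic}(X)$. For a divisor $E$ put $H^0(X,E)=\{f\in k(X): f=0 \text{ or } \operatorname{div}(f)+E\ge 0\}$, and let $$\operatorname{Cox}(X)=\bigoplus_{m\in\mathbb{Z}^r}H^0(X,m_1D_1+\dots+m_rD_r)$$ be the Cox ring, with the multiplication induced by that of $k(X)$. Identify $m\in\mathbb{Z}^r$ with the divisor $m_1D_1+\dots+m_rD_r$. Assume that $\operatorname{Cox}(X)$ is a finitely generated $k$-algebra (i.e. $X$ is a Mori dream space) and fix a presentation $R/I\cong\operatorname{Cox}(X)$, $R=k[x_1,\dots,x_n]$, in which the image of each variable $x_i$ (again denoted $x_i$) is an irreducible element of $\operatorname{Cox}(X)$, homogeneous of some degree $C_i\in\mathbb{Z}^r$. Grade $R$ by $\deg x_i=C_i$. For $D\in\mathbb{Z}^r$ and $j\ge 0$ let $$\mathbb{A}_j(D)=\bigoplus_{1\le i_1<\dots<i_j\le n}H^0(X,D-C_{i_1}-\dots-C_{i_j})$$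 (so $\mathbb{A}_0(D)=H^0(X,D)$ and $\mathbb{A}_j(D)=0$ for $j>n$), and let $d:\mathbb{A}_j(D)\to\mathbb{A}_{j-1}(D)$, $j\ge1$, be given by $$d(f\,u_{i_1\dots i_j})=\sum_{s=1}^{j}(-1)^{s+1}\,x_{i_s}f\;u_{i_1\dots\widehat{i_s}\dots i_j},$$ where $f\,u_{i_1\dots i_j}$ denotes $f\in H^0(X,D-C_{i_1}-\dots-C_{i_j})$ placed in the summand indexed by $i_1<\dots<i_j$. Then: 1. $(\mathbb{A}(D),d)$ is a complex, i.e. $d\circ d=0$, for every $D\in\mathbb{Z}^r$. 2. The graded $R$-module $\operatorname{Cox}(X)$ has a minimal $\mathbb{Z}^r$-graded free resolution $\cdots\to F_1\to F_0\to\operatorname{Cox}(X)\to0$ by finitely generated graded free $R$-modules (minimal means that the image of $F_{i+1}$ lies in $(x_1,\dots,x_n)F_i$ for all $i\ge 0$). For every such resolution, writing $F_i=\bigoplus_{D\in\mathbb{Z}^r}R(-D)^{b_{i,D}}$, all $i\ge0$ and $D\in\mathbb{Z}^r$ satisfy $$b_{i,D}=\dim_k H_i(\mathbb{A}(D))<\infty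 .$$ That is, $b_{i,D}(\operatorname{Cox}(X))=\dim_k H_i(\mathbb{A}(D))$. -/

import Mathlib

open AlgebraicGeometry CategoryTheory DirectSum

universe u

noncomputable section

namespace CoxSyzygy

/-! ### Projective schemes over a field -/

section Projective

variable (k : Type u) [Field k]

attribute [local instance] MvPolynomial.gradedAlgebra

/-- Projective `N`-space over `k`, as `Proj` of the standard graded ring `k[T₀, …, T_N]`. -/
abbrev ProjSpace (N : ℕ) : Scheme.{u} :=
  Proj (MvPolynomial.homogeneousSubmodule (Fin (N + 1)) k)

/-- The structure morphism of projective `N`-space over `k`. -/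
def projSpaceStructure (N : ℕ) : ProjSpace k N ⟶ Spec (.of k) :=
  Proj.toSpecZero (MvPolynomial.homogeneousSubmodule (Fin (N + 1)) k) ≫
    Spec.map (CommRingCat.ofHom
      (algebraMap k (MvPolynomial.homogeneousSubmodule (Fin (N + 1)) k 0)))

/-- A `k`-scheme is projective if it admits a closed immersion over `k` into some projective
space over `k`. -/
def IsProjective (X : Scheme.{u}) [X.Over (Spec (.of k))] : Prop :=
  ∃ (N : ℕ) (ι : X ⟶ ProjSpace k N),
    IsClosedImmersion ι ∧ ι ≫ projSpaceStructure k N = X ↘ Spec (.of k)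

end Projective

/-! ### Rational functions, divisors and their sections

`X` is an integral scheme over a field `k`. -/

section Divisors

variable (k : Type u) [Field k] (X : Scheme.{u}) [X.Over (Spec (.of k))] [IsIntegral X]

/-- The function field `k(X)`; `k` is recorded in order to make it a `k`-algebra. -/
def RatFun (_k : Type u) [Field _k] (X : Scheme.{u}) [X.Over (Spec (.of _k))] [IsIntegral X] :
    Type u := X.functionField

instance : Field (RatFun k X) := inferInstanceAs (Field X.functionField)

/-- A constant, as a global regular function on `X`. -/
def constants : k →+* Γ(X, ⊤) :=
  (X ↘ Spec (.of k)).appTop.hom.comp (Scheme.ΓSpecIso (.of k)).inv.hom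

instance : Nonempty (⊤ : X.Opens) := ⟨⟨genericPoint X, trivial⟩⟩

instance : Algebra k (RatFun k X) :=
  RingHom.toAlgebra ((X.germToFunctionField ⊤).hom.comp (constants k X))

/-- The local ring `O_{X,x}`, as a subalgebra of the function field `k(X)`. -/
def localRing (x : X) : Subalgebra k (RatFun k X) where
  toSubsemiring := (algebraMap (X.presheaf.stalk x) X.functionField).rangeS
  algebraMap_mem' c := ⟨X.presheaf.germ ⊤ x trivial (constants k X c),
    Scheme.algebraMap_germ_eq_germToFunctionField (X := X) (U := ⊤) trivial _⟩

/-- The group of units `O_{X,x}ˣ`, as a subgroup of `k(X)ˣ`. -/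
def localUnits (x : X) : Subgroup (RatFun k X)ˣ :=
  (Units.map (localRing k X x).val.toRingHom.toMonoidHom).range

/-- The possible germs at `x` of divisors: `k(X)ˣ / O_{X,x}ˣ`, written additively. -/
def DivisorGerm (x : X) : Type u := Additive ((RatFun k X)ˣ ⧸ localUnits k X x)

instance (x : X) : AddCommGroup (DivisorGerm k X x) :=
  inferInstanceAs (AddCommGroup (Additive ((RatFun k X)ˣ ⧸ localUnits k X x)))

/-- The germ at `x` of the divisor of the rational function `f`. -/
def divGerm (x : X) (f : (RatFun k X)ˣ) : DivisorGerm k X x :=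
  Additive.ofMul (QuotientGroup.mk f)

variable {k X} in
theorem divGerm_mul (x : X) (f g : (RatFun k X)ˣ) :
    divGerm k X x (f * g) = divGerm k X x f + divGerm k X x g := rfl

variable {k X} in
theorem divGerm_inv (x : X) (f : (RatFun k X)ˣ) :
    divGerm k X x f⁻¹ = - divGerm k X x f := rfl

variable {k X} in
theorem divGerm_one (x : X) : divGerm k X x 1 = 0 := rfl

variable {k X} in
theorem divGerm_surjective (x : X) : Function.Surjective (divGerm k X x) :=
  fun y => QuotientGroup.mk_surjective (Additive.toMul y)

/-- The group of (Cartier) divisors on `X`, i.e. of global sections of the sheaf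
`k(X)ˣ / O_Xˣ`: families of germs that are, locally on `X`, given by one rational function (a
local equation). On a smooth variety this is the group of all divisors. -/
def divisorSubgroup : AddSubgroup (∀ x : X, DivisorGerm k X x) where
  carrier := {E | ∀ x : X, ∃ U : X.Opens, x ∈ U ∧ ∃ f : (RatFun k X)ˣ,
    ∀ y ∈ U, E y = divGerm k X y f}
  zero_mem' := fun _ => ⟨⊤, trivial, 1, fun _ _ => rfl⟩
  add_mem' := by
    intro E F hE hF x
    obtain ⟨U, hxU, f, hf⟩ := hE x
    obtain ⟨V, hxV, g, hg⟩ := hF x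
    refine ⟨U ⊓ V, ⟨hxU, hxV⟩, f * g, fun y hy => ?_⟩
    rw [Pi.add_apply, hf y hy.1, hg y hy.2, divGerm_mul]
  neg_mem' := by
    intro E hE x
    obtain ⟨U, hxU, f, hf⟩ := hE x
    refine ⟨U, hxU, f⁻¹, fun y hy => ?_⟩
    rw [Pi.neg_apply, hf y hy, divGerm_inv]

/-- The type of divisors on `X`, an abelian group. -/
def Divisor : Type u := divisorSubgroup k X

instance : AddCommGroup (Divisor k X) := inferInstanceAs (AddCommGroup (divisorSubgroup k X))

/-- The principal divisor of a nonzero rational function. -/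
def principal : Additive (RatFun k X)ˣ →+ Divisor k X where
  toFun f := ⟨fun x => divGerm k X x f.toMul, fun _ => ⟨⊤, trivial, f.toMul, fun _ _ => rfl⟩⟩
  map_zero' := rfl
  map_add' _ _ := rfl

/-- The Picard group of `X`: divisors modulo linear equivalence. -/
abbrev Picard : Type u := Divisor k X ⧸ (principal k X).range

variable {k X}

/-- A divisor is effective if its local equations are regular functions. -/
def IsEffective (E : Divisor k X) : Prop :=
  ∀ (x : X) (g : (RatFun k X)ˣ), divGerm k X x g = E.1 x → (g : RatFun k X) ∈ localRing k X x

/-- `H⁰(X, E)`: the rational functions `f` with `f = 0` or `div f + E ≥ 0`, i.e. those for which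
`f g` is regular at `x` whenever `g` is a local equation of `E` at the point `x`. -/
def H0 (E : Divisor k X) : Submodule k (RatFun k X) where
  carrier := {f | ∀ (x : X) (g : (RatFun k X)ˣ), divGerm k X x g = E.1 x →
    f * (g : RatFun k X) ∈ localRing k X x}
  zero_mem' := fun x _ _ => by rw [zero_mul]; exact zero_mem _
  add_mem' := fun hf hf' x g hg => by
    rw [add_mul]; exact add_mem (hf x g hg) (hf' x g hg)
  smul_mem' := fun c f hf x g hg => by
    rw [smul_mul_assoc]; exact Subalgebra.smul_mem _ (hf x g hg) c

theorem one_mem_H0_zero : (1 : RatFun k X) ∈ H0 (0 : Divisor k X) := by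
  intro x g hg
  have h1 : (QuotientGroup.mk g : (RatFun k X)ˣ ⧸ localUnits k X x) = 1 := hg
  obtain ⟨v, hv⟩ := (QuotientGroup.eq_one_iff g).1 h1
  rw [one_mul, ← hv]
  exact v.1.2

theorem mul_mem_H0_add {E F : Divisor k X} {f h : RatFun k X} (hf : f ∈ H0 E) (hh : h ∈ H0 F) :
    f * h ∈ H0 (E + F) := by
  intro x g hg
  obtain ⟨a, ha⟩ := divGerm_surjective x (E.1 x)
  have hb : divGerm k X x (a⁻¹ * g) = F.1 x := by
    rw [divGerm_mul, divGerm_inv, ha, hg]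
    exact neg_add_cancel_left (E.1 x) (F.1 x)
  have := mul_mem (hf x a ha) (hh x _ hb)
  have e : f * (a : RatFun k X) * (h * ((a⁻¹ * g : (RatFun k X)ˣ) : RatFun k X))
      = f * h * (g : RatFun k X) := by
    have ha0 : (a : RatFun k X) ≠ 0 := a.ne_zero
    rw [Units.val_mul, Units.val_inv_eq_inv_val]
    field_simp
  rwa [e] at this

end Divisors

/-! ### The Cox ring -/

section Cox

variable {k : Type u} [Field k] {X : Scheme.{u}} [X.Over (Spec (.of k))] [IsIntegral X]
variable {r : ℕ} (D : Fin r → Divisor k X)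

/-- The classes of `D₁, …, D_r` form a `ℤ`-basis of `Pic(X)`. -/
def IsPicardBasis : Prop :=
  LinearIndependent ℤ (fun i => (QuotientAddGroup.mk (D i) : Picard k X)) ∧
    Submodule.span ℤ (Set.range fun i => (QuotientAddGroup.mk (D i) : Picard k X)) = ⊤

/-- `H⁰(X, m₁D₁ + ⋯ + m_rD_r)`. -/
def coxPiece (m : Fin r → ℤ) : Submodule k (RatFun k X) := H0 (∑ i, m i • D i)

instance : SetLike.GradedMonoid (coxPiece D) where
  one_mem := by
    have : (∑ i, (0 : Fin r → ℤ) i • D i) = 0 := by simp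
    rw [coxPiece, this]
    exact one_mem_H0_zero
  mul_mem := by
    intro m m' f g hf hg
    have : (∑ i, (m + m') i • D i) = (∑ i, m i • D i) + ∑ i, m' i • D i := by
      simp only [Pi.add_apply, add_smul, Finset.sum_add_distrib]
    rw [coxPiece, this]
    exact mul_mem_H0_add hf hg

/-- The Cox ring `⨁_{m ∈ ℤ^r} H⁰(X, m₁D₁ + ⋯ + m_rD_r)`, a commutative `k`-algebra with the
multiplication induced by that of `k(X)`. -/
abbrev CoxRing : Type u := ⨁ m : Fin r → ℤ, coxPiece D m

/-- A presentation `k[x₁, …, x_n] / I ≅ Cox(X)` of the Cox ring: a surjection from the polynomial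
ring (`I` being its kernel) which sends every variable `x_i` to an irreducible element of `Cox(X)`,
homogeneous of degree `C_i ∈ ℤ^r`. -/
structure CoxPresentation (n : ℕ) where
  /-- the degrees `C_i` -/
  C : Fin n → Fin r → ℤ
  /-- the images of the variables -/
  x : ∀ i, coxPiece D (C i)
  irreducible_x : ∀ i, Irreducible (DirectSum.of (fun m => coxPiece D m) (C i) (x i) : CoxRing D)
  surjective : Function.Surjective (MvPolynomial.aeval (R := k)
    fun i => (DirectSum.of (fun m => coxPiece D m) (C i) (x i) : CoxRing D))

variable {D} {n : ℕ} (P : CoxPresentation D n)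

/-- The presentation homomorphism `k[x₁, …, x_n] → Cox(X)`. -/
def CoxPresentation.toCox : MvPolynomial (Fin n) k →ₐ[k] CoxRing D :=
  MvPolynomial.aeval fun i => DirectSum.of (fun m => coxPiece D m) (P.C i) (P.x i)

/-- The Cox ring regarded as a module over the polynomial ring `k[x₁, …, x_n]`. -/
def CoxPresentation.Mod (_P : CoxPresentation D n) : Type u := CoxRing D

instance : AddCommGroup P.Mod := inferInstanceAs (AddCommGroup (CoxRing D))

instance : Module (MvPolynomial (Fin n) k) P.Mod :=
  Module.compHom (CoxRing D) P.toCox.toRingHom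

/-- The homogeneous part of degree `m` of the Cox ring. -/
def CoxPresentation.modPiece (m : Fin r → ℤ) : AddSubgroup P.Mod :=
  (DirectSum.of (fun m => coxPiece D m) m).range

end Cox

/-! ### Minimal graded free resolutions and graded Betti numbers -/

section Resolution

variable (k : Type*) [Field k] {σ : Type*} {G : Type*} [AddCommGroup G]

/-- A minimal graded free resolution
`⋯ → F₂ → F₁ → F₀ → M → 0` of the graded module `M = ⨁ M_g` over the polynomial ring
`R = k[x_s : s ∈ σ]`, graded by giving `x_s` the degree `w s ∈ G`. Here `F_i` is the free module
`⨁_a R(-shift i a)`, all maps are homogeneous of degree `0`, and minimality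
means that the image of `F_{i+1}` lies in `(x_s : s ∈ σ) F_i`. -/
structure MinimalGradedFreeResolution (w : σ → G) (M : Type*) [AddCommGroup M]
    [Module (MvPolynomial σ k) M] (𝓜 : G → AddSubgroup M) where
  /-- the rank of `F_i` -/
  rank : ℕ → ℕ
  /-- the degrees of the basis vectors of `F_i` -/
  shift : ∀ i, Fin (rank i) → G
  /-- the augmentation `F₀ → M` -/
  aug : (Fin (rank 0) → MvPolynomial σ k) →ₗ[MvPolynomial σ k] M
  /-- the differentials `F_{i+1} → F_i` -/
  d : ∀ i, (Fin (rank (i + 1)) → MvPolynomial σ k) →ₗ[MvPolynomial σ k]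
    (Fin (rank i) → MvPolynomial σ k)
  aug_homogeneous : ∀ a, aug (Pi.single a 1) ∈ 𝓜 (shift 0 a)
  d_homogeneous : ∀ i a b, MvPolynomial.IsWeightedHomogeneous w (d i (Pi.single a 1) b)
    (shift (i + 1) a - shift i b)
  aug_surjective : Function.Surjective aug
  exact_zero : LinearMap.range (d 0) = LinearMap.ker aug
  exact_succ : ∀ i, LinearMap.range (d (i + 1)) = LinearMap.ker (d i)
  minimal : ∀ i a b, d i (Pi.single a 1) b ∈ Ideal.span (Set.range fun s : σ => (MvPolynomial.X s : MvPolynomial σ k))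

/-- The multiplicity of `R(-g)` in the `i`-th module of the resolution. -/
def MinimalGradedFreeResolution.betti {k : Type*} [Field k] {w : σ → G} {M : Type*} [AddCommGroup M]
    [Module (MvPolynomial σ k) M] {𝓜 : G → AddSubgroup M}
    (F : MinimalGradedFreeResolution k w M 𝓜) (i : ℕ) (g : G) : ℕ :=
  Nat.card {a : Fin (F.rank i) // F.shift i a = g}

end Resolution

/-! ### The sequences `𝔸(D)` -/

section Sequence

variable {k : Type u} [Field k] {X : Scheme.{u}} [X.Over (Spec (.of k))] [IsIntegral X]
variable {r : ℕ} {D : Fin r → Divisor k X} {n : ℕ} (P : CoxPresentation D n) (m : Fin r → ℤ)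

/-- Multiplication by `x_i`, as a map
`H⁰(X, D - ∑_{t ∈ S} C_t) → H⁰(X, D - ∑_{t ∈ S ∖ {i}} C_t)` for `i ∈ S`. -/
def mulGen (S : Finset (Fin n)) (i : Fin n) (hi : i ∈ S) :
    coxPiece D (m - ∑ t ∈ S, P.C t) →ₗ[k] coxPiece D (m - ∑ t ∈ S.erase i, P.C t) where
  toFun f := ⟨(P.x i : RatFun k X) * f, by
    have h : P.C i + (m - ∑ t ∈ S, P.C t) = m - ∑ t ∈ S.erase i, P.C t := by
      rw [← Finset.add_sum_erase S P.C hi]; abel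
    rw [← h]
    exact SetLike.mul_mem_graded (P.x i).2 f.2⟩
  map_add' f g := Subtype.ext (mul_add _ _ _)
  map_smul' c f := Subtype.ext (mul_smul_comm c _ _)

/-- `𝔸_j = ⨁_{i₁ < ⋯ < i_j} H⁰(X, D - C_{i₁} - ⋯ - C_{i_j})` for `D = m₁D₁ + ⋯ + m_rD_r`; the sum
is over the `j`-element subsets of `{1, …, n}`. -/
abbrev A (j : ℕ) : Type u :=
  ⨁ S : {S : Finset (Fin n) // S.card = j}, coxPiece D (m - ∑ t ∈ S.1, P.C t)

instance (j : ℕ) : AddCommGroup (A P m j) := inferInstance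

/-- The differential `𝔸_{j+1} → 𝔸_j`, which on the summand indexed by `S = {i₁ < ⋯ < i_{j+1}}` is
`u_S ↦ ∑_s (-1)^{s+1} x_{i_s} u_{S ∖ {i_s}}`; if `i = i_s` then `s - 1` elements of `S` are smaller
than `i`. -/
def dA (j : ℕ) : A P m (j + 1) →ₗ[k] A P m j :=
  DirectSum.toModule k _ _ fun S => ∑ i : {i // i ∈ S.1},
    ((-1 : k) ^ (S.1.filter (· < i.1)).card) •
      (DirectSum.lof k {T : Finset (Fin n) // T.card = j}
          (fun T => coxPiece D (m - ∑ t ∈ T.1, P.C t))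
          ⟨S.1.erase i.1, by rw [Finset.card_erase_of_mem i.2, S.2]; rfl⟩ ∘ₗ
        mulGen P m S.1 i.1 i.2)

/-- The cycles in `𝔸_i`; the sequence is continued by `0` to the right of `𝔸₀`. -/
def cyclesA : ∀ i : ℕ, Submodule k (A P m i)
  | 0 => ⊤
  | i + 1 => LinearMap.ker (dA P m i)

/-- The homology `H_i(𝔸(D))`: cycles modulo boundaries. -/
abbrev homologyA (i : ℕ) : Type u :=
  cyclesA P m i ⧸ (LinearMap.range (dA P m i)).submoduleOf (cyclesA P m i)

end Sequence

end CoxSyzygy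

end

/-!
The graded Betti numbers of `Cox(X)` over `R = k[x₁, …, x_n]` are the dimensions of the graded
pieces of `Tor_i^R(Cox(X), k)`, and `𝔸(D)` is the part of degree `D` of the Koszul complex of
`x₁, …, x_n` with coefficients in `Cox(X)`, which computes the same `Tor`.

Instead of comparing two computations of `Tor`, the proof shifts dimensions along the given minimal
resolution. Let `φ : F → M` be a graded free cover whose kernel `K` lies in `(x₁, …, x_n) F`. The
Koszul complex of `F` is exact in positive degrees, by an explicit contracting homotopy
(`koszulD_koszulHomotopy`), and its boundaries in degree `0` are the elements of
`(x₁, …, x_n) F`. It follows that `H_{j+1}(M) ≅ H_j(K)` for the graded Koszul homology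
(`koszulHomology_succ_equiv`), and that `H_0(M)` has in degree `m` a basis indexed by the basis
vectors of `F` of degree `m` (`koszulHomology_zero_equiv`). Since the resolution of `M`, without its
module `F₀`, is a minimal resolution of `K`, induction gives the formula for all Betti numbers
(`MinimalGradedFreeResolution.nonempty_koszulHomology_equiv`).

Minimal resolutions exist because a homogeneous generating system of minimal cardinality has only
relations with coefficients in `(x₁, …, x_n)` (`exists_minimal_generators`); this requires that the
nonzero polynomials of degree `0` are constants. Here the geometry enters: `X` being projective and
integral, its global regular functions form a field, so a nonempty product of variables of degree
`0` would be invertible in `Cox(X)`, contrary to the irreducibility of its factors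
(`CoxPresentation.eq_zero_of_weight_eq_zero`). It also uses that `R` is Noetherian.
-/

namespace CoxSyzygy

/-! ### Global regular functions on a projective variety -/

section GlobalFunctions

attribute [local instance] MvPolynomial.gradedAlgebra in
theorem isProper_projSpaceStructure (k : Type u) [Field k] (N : ℕ) :
    IsProper (projSpaceStructure k N) := by
  let 𝒜 := MvPolynomial.homogeneousSubmodule (Fin (N + 1)) k
  have hsurj : Function.Surjective (algebraMap k (𝒜 0)) := by
    rintro ⟨p, hp⟩
    refine ⟨MvPolynomial.coeff 0 p, Subtype.ext ?_⟩
    exact (MvPolynomial.totalDegree_eq_zero_iff_eq_C.1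
      (Nat.le_zero.1 (MvPolynomial.IsHomogeneous.totalDegree_le hp))).symm
  have : IsScalarTower k (𝒜 0) (MvPolynomial (Fin (N + 1)) k) :=
    IsScalarTower.of_algebraMap_eq (R := k) (S := 𝒜 0) (A := MvPolynomial (Fin (N + 1)) k)
      fun _ => rfl
  have : Algebra.FiniteType (𝒜 0) (MvPolynomial (Fin (N + 1)) k) :=
    Algebra.FiniteType.of_restrictScalars_finiteType k _ _
  have : IsProper (Proj.toSpecZero 𝒜) := inferInstance
  have : IsClosedImmersion (Spec.map (CommRingCat.ofHom (algebraMap k (𝒜 0)))) :=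
    IsClosedImmersion.spec_of_surjective _ hsurj
  unfold projSpaceStructure
  infer_instance

variable {k : Type u} [Field k] {X : Scheme.{u}} [X.Over (Spec (.of k))] [IsIntegral X]

theorem IsProjective.isField_globalSections (hX : IsProjective k X) : IsField Γ(X, ⊤) := by
  obtain ⟨N, ι, hι, h⟩ := hX
  have := isProper_projSpaceStructure k N
  have : UniversallyClosed (ι ≫ projSpaceStructure k N) := inferInstance
  rw [h] at this
  exact isField_of_universallyClosed k (X ↘ Spec (.of k))

/-- A rational function that is regular at every point is a global regular function: local
representatives agree on overlaps because sections of an integral scheme are determined by their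
germ at the generic point. -/
theorem exists_globalSection_of_forall_mem_localRing {f : RatFun k X}
    (hf : ∀ x, f ∈ localRing k X x) : ∃ s : Γ(X, ⊤), X.germToFunctionField ⊤ s = f := by
  have hloc : ∀ x : X, ∃ (U : X.Opens) (hx : x ∈ U) (s : Γ(X, U)),
      algebraMap (X.presheaf.stalk x) X.functionField (X.presheaf.germ U x hx s) = f := by
    intro x
    obtain ⟨t, ht⟩ := hf x
    obtain ⟨U, hx, s, rfl⟩ := X.presheaf.exists_germ_eq t
    exact ⟨U, hx, s, ht⟩
  choose U hxU s hs using hloc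
  have : ∀ x, Nonempty (U x) := fun x => ⟨⟨x, hxU x⟩⟩
  have hs' : ∀ x, X.germToFunctionField (U x) (s x) = f := fun x => by
    exact (Scheme.algebraMap_germ_eq_germToFunctionField X (hxU x) (s x)).symm.trans (hs x)
  obtain ⟨gl, hgl, -⟩ := X.sheaf.existsUnique_gluing' U ⊤ (fun x => homOfLE le_top)
    (fun x _ => TopologicalSpace.Opens.mem_iSup.2 ⟨x, hxU x⟩) s (by
      intro x y
      have hgen : genericPoint X ∈ U x ⊓ U y :=
        ⟨((genericPoint_spec X).mem_open_set_iff (U x).isOpen).2 ⟨x, trivial, hxU x⟩,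
          ((genericPoint_spec X).mem_open_set_iff (U y).isOpen).2 ⟨y, trivial, hxU y⟩⟩
      apply germ_injective_of_isIntegral X (genericPoint X) hgen
      erw [X.presheaf.germ_res_apply, X.presheaf.germ_res_apply]
      exact (hs' x).trans (hs' y).symm)
  obtain ⟨x⟩ : Nonempty X := inferInstance
  refine ⟨gl, ?_⟩
  rw [← hs' x, ← hgl x]
  exact (X.presheaf.germ_res_apply (homOfLE le_top) _ _ gl).symm

/-- On a projective variety the nonzero elements of `H⁰(X, 0)` are invertible there. -/
theorem inv_mem_H0_zero (hX : IsProjective k X) {f : RatFun k X}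
    (hf : f ∈ H0 (0 : Divisor k X)) : f⁻¹ ∈ H0 (0 : Divisor k X) := by
  by_cases hf0 : f = 0
  · rw [hf0, inv_zero]
    exact zero_mem _
  obtain ⟨s, hs⟩ := exists_globalSection_of_forall_mem_localRing (f := f) fun x => by
    have := hf x 1 (divGerm_one x)
    rwa [Units.val_one, mul_one] at this
  have hs0 : s ≠ 0 := by
    rintro rfl
    exact hf0 (hs.symm.trans (map_zero (X.germToFunctionField ⊤).hom))
  obtain ⟨t, ht⟩ := hX.isField_globalSections.mul_inv_cancel hs0
  have hft : f * (show RatFun k X from X.germToFunctionField ⊤ t) = 1 := by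
    rw [← hs]
    exact ((X.germToFunctionField ⊤).hom.map_mul s t).symm.trans
      ((congrArg _ ht).trans (map_one (X.germToFunctionField ⊤).hom))
  rw [inv_eq_of_mul_eq_one_right hft]
  intro x g hg
  have hg1 := one_mem_H0_zero (k := k) (X := X) x g hg
  rw [one_mul] at hg1
  exact mul_mem ⟨X.presheaf.germ ⊤ x trivial t,
    Scheme.algebraMap_germ_eq_germToFunctionField (X := X) (U := ⊤) trivial t⟩ hg1

end GlobalFunctions

/-! ### The degrees of the generators of the Cox ring -/

section Pointed

variable {k : Type u} [Field k] {X : Scheme.{u}} [X.Over (Spec (.of k))] [IsIntegral X]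
variable {r : ℕ} {D : Fin r → Divisor k X} {n : ℕ}

theorem CoxPresentation.x_ne_zero (P : CoxPresentation D n) (i : Fin n) :
    (P.x i : RatFun k X) ≠ 0 := by
  intro h
  apply (P.irreducible_x i).ne_zero
  rw [show P.x i = 0 from Subtype.ext h, map_zero]

/-- The degrees of the generators span a strongly convex cone: a monomial of degree `0` lies in the
field `H⁰(X, 0)`, hence is invertible in the Cox ring, and so it involves no irreducible element. -/
theorem CoxPresentation.eq_zero_of_weight_eq_zero (hX : IsProjective k X) (P : CoxPresentation D n)
    (a : Fin n →₀ ℕ) (ha : Finsupp.weight P.C a = 0) : a = 0 := by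
  have hmem : ∀ b : Fin n →₀ ℕ,
      (∏ i, (P.x i : RatFun k X) ^ b i) ∈ coxPiece D (Finsupp.weight P.C b) := by
    intro b
    rw [Finsupp.weight_apply, Finsupp.sum_fintype _ _ (by simp)]
    exact SetLike.prod_mem_graded _ _ _ fun i _ => SetLike.pow_mem_graded _ (P.x i).2
  by_contra hne
  obtain ⟨i, hi⟩ := Finsupp.ne_iff.1 hne
  apply (P.irreducible_x i).not_isUnit
  set f : RatFun k X := ∏ i, (P.x i : RatFun k X) ^ a i with hf
  have hf0 : f ≠ 0 := Finset.prod_ne_zero_iff.2 fun i _ => pow_ne_zero _ (P.x_ne_zero i)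
  have hpiece : coxPiece D 0 = H0 0 := by simp [coxPiece]
  have hfinv : f⁻¹ ∈ coxPiece D 0 := by
    rw [hpiece]
    apply inv_mem_H0_zero hX
    rw [← hpiece, ← ha]
    exact hmem a
  -- `g` is the monomial with one factor `x_i` removed
  let b : Fin n →₀ ℕ := a - Finsupp.single i 1
  have hab : Finsupp.single i 1 + b = a := by
    apply add_tsub_cancel_of_le
    rw [Finsupp.single_le_iff]
    exact Nat.one_le_iff_ne_zero.2 hi
  have hg := SetLike.mul_mem_graded (hmem b) hfinv
  set g : RatFun k X := (∏ i, (P.x i : RatFun k X) ^ b i) * f⁻¹ with hgdef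
  have hxg : (P.x i : RatFun k X) * g = 1 := by
    have : (P.x i : RatFun k X) * ∏ l, (P.x l : RatFun k X) ^ b l = f := by
      rw [hf, ← hab]
      simp only [Finsupp.add_apply, pow_add, Finset.prod_mul_distrib]
      congr 1
      rw [Finset.prod_eq_single i]
      · simp
      · intro l _ hl
        rw [Finsupp.single_eq_of_ne hl, pow_zero]
      · simp
    rw [hgdef, ← mul_assoc, this, mul_inv_cancel₀ hf0]
  refine IsUnit.of_mul_eq_one (DirectSum.of (fun m => coxPiece D m) _ ⟨g, hg⟩) ?_
  rw [DirectSum.of_mul_of, DirectSum.one_def]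
  apply DirectSum.of_eq_of_gradedMonoid_eq
  refine Sigma.subtype_ext ?_ hxg
  change P.C i + (Finsupp.weight P.C b + 0) = 0
  rw [add_zero, ← ha, ← hab, map_add, Finsupp.weight_single, one_smul]

end Pointed

open MvPolynomial

/-! ### Graded modules over a weighted polynomial ring -/

section Grading

variable {k : Type*} [Field k] {n : ℕ} {G : Type*} [AddCommGroup G]

/-- A grading, by the group `G`, of a module over `k[x₁, …, x_n]` in which `x_i` has degree `w i`.
That the sum of the homogeneous pieces is direct is recorded by linear maps `proj g` that are the
identity on the piece of degree `g` and vanish on the others. The pieces are not required to span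
the module: where this is needed, homogeneous generators are assumed or constructed. -/
structure PolyGrading (w : Fin n → G) (M : Type*) [AddCommGroup M] [Module k M]
    [Module (MvPolynomial (Fin n) k) M] where
  /-- the homogeneous elements of a given degree -/
  piece : G → Submodule k M
  /-- the projection onto the homogeneous component of a given degree -/
  proj : G → M →ₗ[k] M
  proj_of_mem : ∀ {g y}, y ∈ piece g → proj g y = y
  proj_of_mem_ne : ∀ {g h y}, y ∈ piece h → h ≠ g → proj g y = 0
  X_smul_mem : ∀ {g y} (i), y ∈ piece g → (X i : MvPolynomial (Fin n) k) • y ∈ piece (g + w i)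

variable {w : Fin n → G} {M N : Type*} [AddCommGroup M] [Module k M]
  [Module (MvPolynomial (Fin n) k) M] [AddCommGroup N] [Module k N]
  [Module (MvPolynomial (Fin n) k) N]

theorem PolyGrading.monomial_smul_mem (𝓜 : PolyGrading (k := k) w M) (e : Fin n →₀ ℕ) {g : G}
    {y : M} (hy : y ∈ 𝓜.piece g) :
    (monomial e 1 : MvPolynomial (Fin n) k) • y ∈ 𝓜.piece (g + Finsupp.weight w e) := by
  induction e using Finsupp.induction_linear generalizing g y with
  | zero => simpa using hy
  | add e f he hf =>
    rw [← mul_one (1 : k), ← monomial_mul, mul_smul, map_add, add_comm (Finsupp.weight w e),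
      ← add_assoc]
    exact he (hf hy)
  | single i c =>
    rw [← X_pow_eq_monomial, Finsupp.weight_single]
    induction c with
    | zero => simpa using hy
    | succ c ih =>
      rw [pow_succ', mul_smul, succ_nsmul, ← add_assoc]
      exact 𝓜.X_smul_mem i ih

/-- The kernel of a homogeneous map, as a graded module. -/
noncomputable def PolyGrading.ker [IsScalarTower k (MvPolynomial (Fin n) k) M]
    (𝓜 : PolyGrading (k := k) w M) (𝓝 : PolyGrading (k := k) w N)
    (φ : M →ₗ[MvPolynomial (Fin n) k] N)
    (hφ : ∀ g u, φ (𝓜.proj g u) = 𝓝.proj g (φ u)) :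
    PolyGrading (k := k) w (LinearMap.ker φ) where
  piece g := (𝓜.piece g).comap ((LinearMap.ker φ).subtype.restrictScalars k)
  proj g :=
    { toFun := fun y => ⟨𝓜.proj g y, by
        rw [LinearMap.mem_ker, hφ, LinearMap.mem_ker.1 y.2, map_zero]⟩
      map_add' := fun y z => Subtype.ext (map_add _ _ _)
      map_smul' := fun c y => Subtype.ext (map_smul _ _ _) }
  proj_of_mem hy := Subtype.ext (𝓜.proj_of_mem hy)
  proj_of_mem_ne hy h := Subtype.ext (𝓜.proj_of_mem_ne hy h)
  X_smul_mem i hy := 𝓜.X_smul_mem i hy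

/-- The graded free module `⨁_a R(-s a)`, whose basis vectors have the degrees `s a`. -/
noncomputable def freeGrading (w : Fin n → G) {b : ℕ} (s : Fin b → G) :
    PolyGrading (k := k) w (Fin b → MvPolynomial (Fin n) k) where
  piece g :=
    { carrier := {u | ∀ a, IsWeightedHomogeneous w (u a) (g - s a)}
      zero_mem' := fun _ => isWeightedHomogeneous_zero _ _ _
      add_mem' := fun hu hv a => (hu a).add (hv a)
      smul_mem' := fun c u hu a => by
        rw [Pi.smul_apply, smul_eq_C_mul]
        exact (hu a).C_mul c }
  proj g := LinearMap.pi fun a =>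
    (weightedHomogeneousComponent w (g - s a)).comp (LinearMap.proj a)
  proj_of_mem hu := funext fun a => (hu a).weightedHomogeneousComponent_same
  proj_of_mem_ne hu h := funext fun a =>
    (hu a).weightedHomogeneousComponent_ne _ fun e => h (sub_left_inj.1 e).symm
  X_smul_mem {g u} i hu a := by
    rw [Pi.smul_apply, smul_eq_mul, add_sub_right_comm, add_comm]
    exact (isWeightedHomogeneous_X k w i).mul (hu a)

theorem single_mem_freeGrading_piece {b : ℕ} {s : Fin b → G} {g : G} {a : Fin b}
    {p : MvPolynomial (Fin n) k} (hp : IsWeightedHomogeneous w p (g - s a)) :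
    Pi.single a p ∈ (freeGrading w s).piece g := by
  intro c
  by_cases h : c = a
  · subst h
    rwa [Pi.single_eq_same]
  · rw [Pi.single_eq_of_ne h]
    exact isWeightedHomogeneous_zero _ _ _

/-- A map from a graded free module that preserves the degrees of the basis vectors preserves
homogeneous components. -/
theorem map_freeGrading_proj [IsScalarTower k (MvPolynomial (Fin n) k) M]
    (𝓜 : PolyGrading (k := k) w M) {b : ℕ} {s : Fin b → G}
    (φ : (Fin b → MvPolynomial (Fin n) k) →ₗ[MvPolynomial (Fin n) k] M)
    (hφ : ∀ a, φ (Pi.single a 1) ∈ 𝓜.piece (s a)) (g : G) (u : Fin b → MvPolynomial (Fin n) k) :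
    φ ((freeGrading w s).proj g u) = 𝓜.proj g (φ u) := by
  suffices h : φ.restrictScalars k ∘ₗ (freeGrading w s).proj g
      = 𝓜.proj g ∘ₗ φ.restrictScalars k from LinearMap.congr_fun h u
  refine LinearMap.pi_ext' fun a => MvPolynomial.linearMap_ext fun e => LinearMap.ext_ring ?_
  have h1 : Pi.single a (monomial e 1) ∈ (freeGrading (k := k) w s).piece
      (s a + Finsupp.weight w e) := by
    apply single_mem_freeGrading_piece
    rw [add_sub_cancel_left]
    exact isWeightedHomogeneous_monomial _ _ _ rfl
  have h2 : φ (Pi.single a (monomial e 1)) ∈ 𝓜.piece (s a + Finsupp.weight w e) := by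
    have : (Pi.single a (monomial e 1) : Fin b → MvPolynomial (Fin n) k)
        = (monomial e 1 : MvPolynomial (Fin n) k) • Pi.single a 1 := by
      rw [← Pi.single_smul, smul_eq_mul, mul_one]
    rw [this, map_smul]
    exact 𝓜.monomial_smul_mem e (hφ a)
  change φ ((freeGrading w s).proj g (Pi.single a (monomial e 1)))
    = 𝓜.proj g (φ (Pi.single a (monomial e 1)))
  by_cases h : s a + Finsupp.weight w e = g
  · subst h
    rw [PolyGrading.proj_of_mem _ h1, 𝓜.proj_of_mem h2]
  · rw [PolyGrading.proj_of_mem_ne _ h1 h, 𝓜.proj_of_mem_ne h2 h, map_zero]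

theorem exists_mem_piece_of_surjective [IsScalarTower k (MvPolynomial (Fin n) k) M]
    (𝓜 : PolyGrading (k := k) w M) {b : ℕ} {s : Fin b → G}
    {φ : (Fin b → MvPolynomial (Fin n) k) →ₗ[MvPolynomial (Fin n) k] M}
    (hφ : ∀ a, φ (Pi.single a 1) ∈ 𝓜.piece (s a)) (hsurj : Function.Surjective φ) {g : G} {y : M}
    (hy : y ∈ 𝓜.piece g) : ∃ u ∈ (freeGrading w s).piece g, φ u = y := by
  obtain ⟨u, rfl⟩ := hsurj y
  refine ⟨(freeGrading w s).proj g u,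
    fun a => weightedHomogeneousComponent_mem w (u a) (g - s a), ?_⟩
  rw [map_freeGrading_proj 𝓜 φ hφ, 𝓜.proj_of_mem hy]

theorem map_mem_piece [IsScalarTower k (MvPolynomial (Fin n) k) M]
    (𝓜 : PolyGrading (k := k) w M) {b : ℕ} {s : Fin b → G}
    {φ : (Fin b → MvPolynomial (Fin n) k) →ₗ[MvPolynomial (Fin n) k] M}
    (hφ : ∀ a, φ (Pi.single a 1) ∈ 𝓜.piece (s a)) {g : G} {u : Fin b → MvPolynomial (Fin n) k}
    (hu : u ∈ (freeGrading w s).piece g) : φ u ∈ 𝓜.piece g := by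
  have : φ u = ∑ a, ∑ e ∈ (u a).support, coeff e (u a) •
      ((monomial e 1 : MvPolynomial (Fin n) k) • φ (Pi.single a 1)) := by
    conv_lhs => rw [← Finset.univ_sum_single u, map_sum]
    refine Finset.sum_congr rfl fun a _ => ?_
    have h1 : (Pi.single a (u a) : Fin b → MvPolynomial (Fin n) k) = u a • Pi.single a 1 := by
      rw [← Pi.single_smul, smul_eq_mul, mul_one]
    rw [h1, map_smul]
    conv_lhs => rw [(u a).as_sum, Finset.sum_smul]
    refine Finset.sum_congr rfl fun e _ => ?_
    rw [← smul_assoc, smul_monomial, smul_eq_mul, mul_one]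
  rw [this]
  refine sum_mem fun a _ => sum_mem fun e he => Submodule.smul_mem _ _ ?_
  have := 𝓜.monomial_smul_mem e (hφ a)
  rwa [hu a (mem_support_iff.1 he), add_sub_cancel] at this

end Grading

/-! ### The Koszul complex of a graded module -/

section Koszul

variable {k : Type*} [Field k] {n : ℕ} {G : Type*} [AddCommGroup G]

/-- The sign `(-1)^{#{t ∈ S : t < i}}`. -/
def koszulSign (i : Fin n) (S : Finset (Fin n)) : ℤ := (-1) ^ (S.filter (· < i)).card

theorem koszulSign_insert_of_lt {i l : Fin n} {S : Finset (Fin n)} (h : l < i) (hl : l ∉ S) :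
    koszulSign i (insert l S) = - koszulSign i S := by
  rw [koszulSign, koszulSign, Finset.filter_insert, if_pos h,
    Finset.card_insert_of_notMem (by simp [hl]), pow_succ, mul_neg_one]

theorem koszulSign_insert_of_le {i l : Fin n} {S : Finset (Fin n)} (h : i ≤ l) :
    koszulSign i (insert l S) = koszulSign i S := by
  rw [koszulSign, koszulSign, Finset.filter_insert, if_neg h.not_gt]

theorem koszulSign_of_le {i : Fin n} {S : Finset (Fin n)} (h : ∀ t ∈ S, i ≤ t) :
    koszulSign i S = 1 := by
  rw [koszulSign, Finset.filter_false_of_mem fun t ht => (h t ht).not_gt]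
  rfl

variable {M N : Type*} [AddCommGroup M] [Module k M] [Module (MvPolynomial (Fin n) k) M]
  [IsScalarTower k (MvPolynomial (Fin n) k) M] [AddCommGroup N] [Module k N]
  [Module (MvPolynomial (Fin n) k) N] [IsScalarTower k (MvPolynomial (Fin n) k) N]

variable (k) in
/-- The Koszul differential with respect to `x₁, …, x_n`. The elements of the Koszul complex
`⋀ Rⁿ ⊗ M` are encoded as families `(u_S)` indexed by all subsets `S` of `{1, …, n}`. -/
noncomputable def koszulD : (Finset (Fin n) → M) →ₗ[k] (Finset (Fin n) → M) where
  toFun u T := ∑ i ∈ Tᶜ, koszulSign i T • (X i : MvPolynomial (Fin n) k) • u (insert i T)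
  map_add' u v := by
    funext T
    simp only [Pi.add_apply, smul_add, Finset.sum_add_distrib]
  map_smul' c u := by
    funext T
    simp only [Pi.smul_apply, RingHom.id_apply, Finset.smul_sum]
    refine Finset.sum_congr rfl fun i _ => ?_
    rw [smul_comm _ c, smul_comm _ c]

theorem koszulD_apply (u : Finset (Fin n) → M) (T : Finset (Fin n)) :
    koszulD k u T = ∑ i ∈ Tᶜ, koszulSign i T • (X i : MvPolynomial (Fin n) k) • u (insert i T) :=
  rfl

theorem koszulD_koszulD (u : Finset (Fin n) → M) : koszulD k (koszulD k u) = 0 := by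
  funext T
  simp only [koszulD_apply, Finset.smul_sum, Finset.sum_sigma', Pi.zero_apply]
  -- the terms for `(i, l)` and `(l, i)` cancel
  refine Finset.sum_involution (fun p _ => ⟨p.2, p.1⟩) ?_ ?_ ?_ ?_
  · rintro ⟨i, l⟩ h
    simp only [Finset.mem_sigma, Finset.mem_compl, Finset.mem_insert, not_or] at h
    obtain ⟨hi, hli, hl⟩ := h
    have hsign : koszulSign i T * koszulSign l (insert i T)
        = -(koszulSign l T * koszulSign i (insert l T)) := by
      rcases lt_or_gt_of_ne hli with h | h
      · rw [koszulSign_insert_of_le h.le, koszulSign_insert_of_lt h hl]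
        ring
      · rw [koszulSign_insert_of_le h.le, koszulSign_insert_of_lt h hi]
        ring
    dsimp only
    rw [smul_comm (X i : MvPolynomial (Fin n) k) (koszulSign l _),
      smul_comm (X l : MvPolynomial (Fin n) k) (koszulSign i _),
      smul_smul (koszulSign i T), smul_smul (koszulSign l T),
      smul_comm (X i : MvPolynomial (Fin n) k) (X l), Finset.insert_comm, hsign,
      neg_smul, neg_add_cancel]
  · rintro ⟨i, l⟩ h _ e
    simp only [Finset.mem_sigma, Finset.mem_compl, Finset.mem_insert, not_or] at h
    exact h.2.1 (congrArg Sigma.fst e)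
  · rintro ⟨i, l⟩ h
    simp only [Finset.mem_sigma, Finset.mem_compl, Finset.mem_insert, not_or] at h ⊢
    exact ⟨h.2.2, fun e => h.2.1 e.symm, h.1⟩
  · intros
    rfl

variable {w : Fin n → G}

/-- The Koszul chains of homological degree `j` and internal degree `m`:
`⨁_{#S = j} M_{m - ∑_{t ∈ S} w t}`. -/
def koszulChain (𝓜 : PolyGrading (k := k) w M) (j : ℕ) (m : G) :
    Submodule k (Finset (Fin n) → M) where
  carrier := {u | ∀ S, u S ∈ 𝓜.piece (m - ∑ t ∈ S, w t) ∧ (S.card ≠ j → u S = 0)}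
  zero_mem' _ := ⟨zero_mem _, fun _ => rfl⟩
  add_mem' hu hv S := ⟨add_mem (hu S).1 (hv S).1, fun h => by
    rw [Pi.add_apply, (hu S).2 h, (hv S).2 h, add_zero]⟩
  smul_mem' c u hu S := ⟨Submodule.smul_mem _ c (hu S).1, fun h => by
    rw [Pi.smul_apply, (hu S).2 h, smul_zero]⟩

theorem koszulD_mem_koszulChain {𝓜 : PolyGrading (k := k) w M} {j : ℕ} {m : G}
    {u : Finset (Fin n) → M} (hu : u ∈ koszulChain 𝓜 (j + 1) m) :
    koszulD k u ∈ koszulChain 𝓜 j m := by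
  refine fun T => ⟨sum_mem fun i hi => zsmul_mem ?_ _, fun hT => Finset.sum_eq_zero fun i hi => ?_⟩
  · have := 𝓜.X_smul_mem i (hu (insert i T)).1
    rwa [Finset.sum_insert (Finset.mem_compl.1 hi), sub_add_eq_sub_sub_swap, sub_add_cancel] at this
  · rw [(hu (insert i T)).2, smul_zero, smul_zero]
    rw [Finset.card_insert_of_notMem (Finset.mem_compl.1 hi)]
    omega

theorem koszulD_comp_map (φ : M →ₗ[MvPolynomial (Fin n) k] N) (u : Finset (Fin n) → M) :
    koszulD k (fun S => φ (u S)) = fun S => φ (koszulD k u S) := by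
  funext T
  simp only [koszulD_apply, map_sum, map_zsmul, map_smul]

/-- The Koszul cycles of homological degree `j` and internal degree `m`. -/
noncomputable def koszulCycles (𝓜 : PolyGrading (k := k) w M) (j : ℕ) (m : G) :
    Submodule k (Finset (Fin n) → M) :=
  LinearMap.ker (koszulD k) ⊓ koszulChain 𝓜 j m

/-- The Koszul homology of homological degree `j` and internal degree `m`. -/
abbrev KoszulHomology (𝓜 : PolyGrading (k := k) w M) (j : ℕ) (m : G) : Type _ :=
  koszulCycles 𝓜 j m ⧸ ((koszulChain 𝓜 (j + 1) m).map (koszulD k)).submoduleOf (koszulCycles 𝓜 j m)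

end Koszul

/-! ### Exactness of the Koszul complex of a free module -/

section Exactness

variable {k : Type*} [Field k] {n : ℕ} {G : Type*} [AddCommGroup G] {w : Fin n → G}

/-- The terms of `f` that involve none of the variables `x_l` with `l < i`. -/
noncomputable def truncate (i : Fin n) (f : MvPolynomial (Fin n) k) : MvPolynomial (Fin n) k :=
  ∑ e ∈ f.support with ∀ l < i, e l = 0, monomial e (coeff e f)

theorem coeff_truncate (i : Fin n) (f : MvPolynomial (Fin n) k) (e : Fin n →₀ ℕ) :
    coeff e (truncate i f) = if ∀ l < i, e l = 0 then coeff e f else 0 := by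
  classical
  simp only [truncate, coeff_sum, coeff_monomial, Finset.sum_ite_eq', Finset.mem_filter,
    mem_support_iff]
  by_cases h : coeff e f = 0 <;> simp [h]

/-- The terms of `f` whose first variable is `x_i`, divided by `x_i`. -/
noncomputable def leadingQuotient (i : Fin n) (f : MvPolynomial (Fin n) k) :
    MvPolynomial (Fin n) k :=
  (truncate i f).divMonomial (Finsupp.single i 1)

theorem coeff_leadingQuotient (i : Fin n) (f : MvPolynomial (Fin n) k) (e : Fin n →₀ ℕ) :
    coeff e (leadingQuotient i f)
      = if ∀ l < i, e l = 0 then coeff (Finsupp.single i 1 + e) f else 0 := by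
  rw [leadingQuotient, coeff_divMonomial, coeff_truncate]
  refine if_congr (forall₂_congr fun l hl => ?_) rfl rfl
  rw [Finsupp.add_apply, Finsupp.single_eq_of_ne hl.ne, zero_add]

theorem leadingQuotient_zero (i : Fin n) : leadingQuotient i (0 : MvPolynomial (Fin n) k) = 0 := by
  ext e
  simp [coeff_leadingQuotient]

theorem leadingQuotient_add (i : Fin n) (f g : MvPolynomial (Fin n) k) :
    leadingQuotient i (f + g) = leadingQuotient i f + leadingQuotient i g := by
  ext e
  simp only [coeff_leadingQuotient, coeff_add]
  split_ifs <;> simp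

/-- `leadingQuotient i` as an additive map. -/
noncomputable def leadingQuotientHom (i : Fin n) :
    MvPolynomial (Fin n) k →+ MvPolynomial (Fin n) k where
  toFun := leadingQuotient i
  map_zero' := leadingQuotient_zero i
  map_add' := leadingQuotient_add i

theorem leadingQuotientHom_apply (i : Fin n) (f : MvPolynomial (Fin n) k) :
    leadingQuotientHom i f = leadingQuotient i f := rfl

theorem leadingQuotient_X_mul_of_lt {i l : Fin n} (h : l < i) (f : MvPolynomial (Fin n) k) :
    leadingQuotient i (X l * f) = 0 := by
  ext e
  rw [coeff_leadingQuotient, coeff_X_mul', coeff_zero]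
  split_ifs with h1 h2
  · simp [Finsupp.single_eq_of_ne h.ne, h1 l h] at h2
  · rfl
  · rfl

theorem leadingQuotient_X_mul_self (i : Fin n) (f : MvPolynomial (Fin n) k) :
    leadingQuotient i (X i * f) = truncate i f := by
  ext e
  rw [coeff_leadingQuotient, coeff_truncate, coeff_X_mul]

theorem leadingQuotient_X_mul_of_gt {i l : Fin n} (h : i < l) (f : MvPolynomial (Fin n) k) :
    leadingQuotient i (X l * f) = X l * leadingQuotient i f := by
  ext e
  rw [coeff_leadingQuotient, coeff_X_mul', coeff_X_mul', coeff_leadingQuotient]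
  have hsupp : l ∈ (Finsupp.single i 1 + e).support ↔ l ∈ e.support := by
    simp [Finsupp.single_eq_of_ne h.ne']
  by_cases hl : l ∈ e.support
  · rw [if_pos (hsupp.2 hl), if_pos hl]
    have h1 : Finsupp.single l 1 ≤ e := by
      rw [Finsupp.single_le_iff]
      exact Nat.one_le_iff_ne_zero.2 (Finsupp.mem_support_iff.1 hl)
    rw [add_tsub_assoc_of_le h1]
    refine if_congr (forall₂_congr fun t ht => ?_) rfl rfl
    rw [Finsupp.tsub_apply, Finsupp.single_eq_of_ne (ht.trans h).ne, tsub_zero]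
  · rw [if_neg (fun h => hl (hsupp.1 h)), if_neg hl, ite_self]

theorem leadingQuotient_isWeightedHomogeneous {f : MvPolynomial (Fin n) k} {g : G}
    (hf : IsWeightedHomogeneous w f g) (i : Fin n) :
    IsWeightedHomogeneous w (leadingQuotient i f) (g - w i) := by
  intro e he
  rw [coeff_leadingQuotient] at he
  have := hf (fun h => he (by rw [h, ite_self]))
  rw [map_add, Finsupp.weight_single, one_smul] at this
  rw [← this, add_sub_cancel_left]

theorem coeff_X_mul_leadingQuotient (i : Fin n) (f : MvPolynomial (Fin n) k) (e : Fin n →₀ ℕ) :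
    coeff e (X i * leadingQuotient i f)
      = if e i ≠ 0 ∧ ∀ l < i, e l = 0 then coeff e f else 0 := by
  rw [coeff_X_mul', coeff_leadingQuotient, ite_and]
  by_cases hi : i ∈ e.support
  · have h1 : Finsupp.single i 1 ≤ e := by
      rw [Finsupp.single_le_iff]
      exact Nat.one_le_iff_ne_zero.2 (Finsupp.mem_support_iff.1 hi)
    rw [if_pos hi, if_pos (Finsupp.mem_support_iff.1 hi), add_tsub_cancel_of_le h1]
    refine if_congr (forall₂_congr fun t ht => ?_) rfl rfl
    rw [Finsupp.tsub_apply, Finsupp.single_eq_of_ne ht.ne, tsub_zero]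
  · rw [if_neg hi, if_neg (fun h => hi (Finsupp.mem_support_iff.2 h))]

/-- Sorting the terms of `f` by their first variable: the terms with first variable `x_i` are
`x_i * leadingQuotient i f`, so those `i` with `P i` contribute the terms that involve some `x_i`
with `P i`. -/
theorem sum_X_mul_leadingQuotient (P : Fin n → Prop) [DecidablePred P]
    (hP : ∀ i l, P i → l < i → P l) (f : MvPolynomial (Fin n) k) (e : Fin n →₀ ℕ) :
    coeff e (∑ i with P i, X i * leadingQuotient i f)
      = if ∃ i, P i ∧ e i ≠ 0 then coeff e f else 0 := by
  simp only [coeff_sum, coeff_X_mul_leadingQuotient]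
  split_ifs with h
  · obtain ⟨i, ⟨hPi, hi⟩, hmin⟩ := WellFounded.has_min (wellFounded_lt (α := Fin n))
      {i | P i ∧ e i ≠ 0} h
    have hlt : ∀ l < i, e l = 0 := fun l hl => by
      by_contra h0
      exact hmin l ⟨hP i l hPi hl, h0⟩ hl
    rw [Finset.sum_eq_single i, if_pos ⟨hi, hlt⟩]
    · intro l _ hl
      rw [if_neg]
      rintro ⟨h1, h2⟩
      rcases lt_or_gt_of_ne hl with h3 | h3
      · exact h1 (hlt l h3)
      · exact hi (h2 i h3)
    · intro h
      exact absurd (Finset.mem_filter.2 ⟨Finset.mem_univ _, hPi⟩) h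
  · exact Finset.sum_eq_zero fun i hi =>
      if_neg fun hi' => h ⟨i, (Finset.mem_filter.1 hi).2, hi'.1⟩

theorem sum_lt_X_mul_leadingQuotient (t : Fin n) (f : MvPolynomial (Fin n) k) :
    ∑ i with i < t, X i * leadingQuotient i f + truncate t f = f := by
  ext e
  rw [coeff_add, sum_X_mul_leadingQuotient _ (fun i l hi hl => hl.trans hi), coeff_truncate]
  by_cases h : ∀ l < t, e l = 0
  · rw [if_neg, if_pos h, zero_add]
    rintro ⟨i, hi, hi'⟩
    exact hi' (h i hi)
  · rw [if_pos, if_neg h, add_zero]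
    push Not at h
    exact h

theorem sum_univ_X_mul_leadingQuotient {f : MvPolynomial (Fin n) k} (hf : coeff 0 f = 0) :
    ∑ i, X i * leadingQuotient i f = f := by
  ext e
  have := sum_X_mul_leadingQuotient (fun _ => True) (fun _ _ _ _ => trivial) f e
  rw [Finset.filter_true] at this
  rw [this]
  split_ifs with h
  · rfl
  · push Not at h
    have : e = 0 := Finsupp.ext fun i => h i trivial
    rw [this, hf]

/-- A contracting homotopy of the Koszul complex of `k[x₁, …, x_n]`: it sends `x^e u_S` to
`(x^e / x_i) u_{S ∪ {i}}` if `i` is the smallest index that occurs in `e` or `S` and does not lie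
in `S`, and to `0` if the smallest index lies in `S`. -/
noncomputable def koszulHomotopy (u : Finset (Fin n) → MvPolynomial (Fin n) k)
    (S : Finset (Fin n)) : MvPolynomial (Fin n) k :=
  if h : S.Nonempty then leadingQuotient (S.min' h) (u (S.erase (S.min' h))) else 0

theorem koszulHomotopy_of_isLeast {u : Finset (Fin n) → MvPolynomial (Fin n) k}
    {S : Finset (Fin n)} {i : Fin n} (hi : i ∈ S) (h : ∀ t ∈ S, i ≤ t) :
    koszulHomotopy u S = leadingQuotient i (u (S.erase i)) := by
  have hS : S.Nonempty := ⟨i, hi⟩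
  have : S.min' hS = i := le_antisymm (S.min'_le i hi) (S.le_min' hS i h)
  rw [koszulHomotopy, dif_pos hS, this]

/-- For a cycle `u` whose component at `∅` has no constant term, `d (h u) = u`. At a nonempty set
`T` with smallest element `t`, the summands of `d (h u)` for `i < t` give the terms of `u T` that
involve some `x_i` with `i < t`, and those for `i > t` give the remaining ones by the cycle
condition at `T ∖ {t}`. -/
theorem koszulD_koszulHomotopy {u : Finset (Fin n) → MvPolynomial (Fin n) k}
    (hu : koszulD k u = 0) (h0 : coeff 0 (u ∅) = 0) : koszulD k (koszulHomotopy u) = u := by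
  funext T
  rcases T.eq_empty_or_nonempty with rfl | hT
  · rw [koszulD_apply, Finset.compl_empty]
    refine (Finset.sum_congr rfl fun i _ => ?_).trans (sum_univ_X_mul_leadingQuotient h0)
    rw [koszulSign_of_le (by simp), one_smul,
      koszulHomotopy_of_isLeast (i := i) (by simp) (by simp)]
    simp
  obtain ⟨t, htT, ht⟩ : ∃ t ∈ T, ∀ l ∈ T, t ≤ l := ⟨T.min' hT, T.min'_mem hT, fun l => T.min'_le l⟩
  -- the equation `(d u)(T \ t) = 0`, divided by `x_t`
  have hcyc : truncate t (u T) + ∑ i ∈ Tᶜ with t < i, koszulSign i (T.erase t) •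
      (X i * leadingQuotient t (u (insert i (T.erase t)))) = 0 := by
    have h1 := congrArg (leadingQuotientHom t) (congrFun hu (T.erase t))
    rw [koszulD_apply, Pi.zero_apply, map_zero, map_sum, Finset.compl_erase,
      Finset.sum_insert (by simpa using htT), Finset.insert_erase htT] at h1
    simp only [map_zsmul, leadingQuotientHom_apply, smul_eq_mul] at h1
    rw [koszulSign_of_le (fun l hl => ht l (Finset.mem_of_mem_erase hl)), one_smul,
      leadingQuotient_X_mul_self] at h1
    rw [← h1, Finset.sum_filter]
    congr 1
    refine Finset.sum_congr rfl fun i hi => ?_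
    split_ifs with hti
    · rw [leadingQuotient_X_mul_of_gt hti]
    · have : i < t := lt_of_le_of_ne (not_lt.1 hti) fun e => Finset.mem_compl.1 hi (e ▸ htT)
      rw [leadingQuotient_X_mul_of_lt this, smul_zero]
  rw [koszulD_apply, ← Finset.sum_filter_add_sum_filter_not _ (fun i => t < i)]
  have hgt : ∑ i ∈ Tᶜ with t < i, koszulSign i T •
      (X i : MvPolynomial (Fin n) k) • koszulHomotopy u (insert i T)
      = - ∑ i ∈ Tᶜ with t < i, koszulSign i (T.erase t) •
      (X i * leadingQuotient t (u (insert i (T.erase t)))) := by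
    rw [← Finset.sum_neg_distrib]
    refine Finset.sum_congr rfl fun i hi => ?_
    obtain ⟨hiT, hti⟩ := Finset.mem_filter.1 hi
    have hsign : koszulSign i T = - koszulSign i (T.erase t) := by
      conv_lhs => rw [← Finset.insert_erase htT]
      exact koszulSign_insert_of_lt hti (T.notMem_erase t)
    rw [koszulHomotopy_of_isLeast (i := t) (Finset.mem_insert_of_mem htT), hsign, neg_smul,
      Finset.erase_insert_of_ne hti.ne', smul_eq_mul]
    intro l hl
    rcases Finset.mem_insert.1 hl with rfl | hl
    · exact hti.le
    · exact ht l hl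
  have hlt : ∑ i ∈ Tᶜ with ¬ t < i, koszulSign i T •
      (X i : MvPolynomial (Fin n) k) • koszulHomotopy u (insert i T)
      = ∑ i with i < t, X i * leadingQuotient i (u T) := by
    have : (Tᶜ.filter fun i => ¬ t < i) = Finset.univ.filter (· < t) := by
      ext i
      simp only [Finset.mem_filter, Finset.mem_compl, Finset.mem_univ, true_and, not_lt]
      refine ⟨fun h => lt_of_le_of_ne h.2 fun e => h.1 (e ▸ htT), fun h => ⟨fun hi => ?_, h.le⟩⟩
      exact (ht i hi).not_gt h
    rw [this]
    refine Finset.sum_congr rfl fun i hi => ?_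
    have hit := (Finset.mem_filter.1 hi).2
    have hle : ∀ l ∈ T, i ≤ l := fun l hl => hit.le.trans (ht l hl)
    have hiT : i ∉ T := fun h => (ht i h).not_gt hit
    rw [koszulSign_of_le hle, one_smul, smul_eq_mul,
      koszulHomotopy_of_isLeast (i := i) (Finset.mem_insert_self i T), Finset.erase_insert hiT]
    intro l hl
    rcases Finset.mem_insert.1 hl with rfl | hl
    · exact le_rfl
    · exact hle l hl
  have := sum_lt_X_mul_leadingQuotient t (u T)
  rw [hgt, hlt, ← eq_neg_of_add_eq_zero_left hcyc, add_comm, this]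

/-- Exactness of the graded Koszul complex of a free module in positive degrees. In degree `0` its
boundaries are the elements with coordinates in the ideal generated by the variables; in positive
degree the hypothesis on `u ∅` holds because `u ∅ = 0`. -/
theorem exists_koszulD_eq {b : ℕ} {s : Fin b → G} {j : ℕ} {m : G}
    {u : Finset (Fin n) → Fin b → MvPolynomial (Fin n) k}
    (hu : u ∈ koszulCycles (freeGrading w s) j m) (h0 : ∀ a, coeff 0 (u ∅ a) = 0) :
    ∃ v ∈ koszulChain (freeGrading w s) (j + 1) m, koszulD k v = u := by
  obtain ⟨hcyc, hchain⟩ := hu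
  refine ⟨fun S a => koszulHomotopy (fun T => u T a) S, fun S => ⟨fun a => ?_, fun hS => ?_⟩, ?_⟩
  · change IsWeightedHomogeneous w (koszulHomotopy (fun T => u T a) S) _
    by_cases hS : S.Nonempty
    · rw [koszulHomotopy, dif_pos hS]
      have := leadingQuotient_isWeightedHomogeneous ((hchain (S.erase (S.min' hS))).1 a)
        (S.min' hS)
      convert this using 1
      rw [← Finset.add_sum_erase S w (S.min'_mem hS)]
      abel
    · rw [koszulHomotopy, dif_neg hS]
      exact isWeightedHomogeneous_zero _ _ _
  · funext a
    change koszulHomotopy (fun T => u T a) S = 0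
    by_cases hS' : S.Nonempty
    · rw [koszulHomotopy, dif_pos hS', (hchain _).2]
      · exact leadingQuotient_zero _
      · rw [Finset.card_erase_of_mem (S.min'_mem hS')]
        have := hS'.card_pos
        omega
    · rw [koszulHomotopy, dif_neg hS']
  · funext S a
    have hproj := fun v : Finset (Fin n) → Fin b → MvPolynomial (Fin n) k =>
      koszulD_comp_map (k := k)
        (LinearMap.proj (R := MvPolynomial (Fin n) k) (φ := fun _ => MvPolynomial (Fin n) k) a) v
    have h1 : koszulD k (fun T => u T a) = 0 := by
      refine (hproj u).trans (funext fun T => ?_)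
      rw [LinearMap.mem_ker.1 hcyc]
      rfl
    have h2 := congrFun (hproj fun S a => koszulHomotopy (fun T => u T a) S) S
    have h3 := congrFun (koszulD_koszulHomotopy h1 (h0 a)) S
    exact h2.symm.trans h3

end Exactness

/-! ### Betti numbers as dimensions of Koszul homology -/

section Betti

theorem nonempty_linearEquiv_of_ker_eq {k W A B : Type*} [Ring k] [AddCommGroup W] [Module k W]
    [AddCommGroup A] [Module k A] [AddCommGroup B] [Module k B] (f : W →ₗ[k] A) (g : W →ₗ[k] B)
    (hf : Function.Surjective f) (hg : Function.Surjective g)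
    (h : ∀ u, f u = 0 ↔ g u = 0) : Nonempty (A ≃ₗ[k] B) :=
  ⟨(f.quotKerEquivOfSurjective hf).symm ≪≫ₗ
    Submodule.quotEquivOfEq (LinearMap.ker f) (LinearMap.ker g) (Submodule.ext h) ≪≫ₗ
    g.quotKerEquivOfSurjective hg⟩

theorem mem_span_range_X_iff {σ R : Type*} [CommSemiring R] {f : MvPolynomial σ R} :
    f ∈ Ideal.span (Set.range fun s : σ => (X s : MvPolynomial σ R)) ↔ coeff 0 f = 0 := by
  change f ∈ Ideal.span (Set.range (X : σ → MvPolynomial σ R)) ↔ _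
  rw [← Set.image_univ, mem_ideal_span_X_image]
  refine ⟨fun h => ?_, fun h e he => ?_⟩
  · by_contra h0
    obtain ⟨i, -, hi⟩ := h 0 (mem_support_iff.2 h0)
    exact hi rfl
  · by_contra! h1
    have : e = 0 := Finsupp.ext fun i => h1 i trivial
    exact mem_support_iff.1 he (this ▸ h)

variable {k : Type*} [Field k] {n : ℕ} {G : Type*} [AddCommGroup G] {w : Fin n → G}
variable {M : Type*} [AddCommGroup M] [Module k M] [Module (MvPolynomial (Fin n) k) M]
  [IsScalarTower k (MvPolynomial (Fin n) k) M]

theorem mkQ_koszulCycles_eq_zero_iff {𝓜 : PolyGrading (k := k) w M} {j : ℕ} {m : G}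
    (z : koszulCycles 𝓜 j m) :
    (Submodule.Quotient.mk z : KoszulHomology 𝓜 j m) = 0 ↔
      ∃ v ∈ koszulChain 𝓜 (j + 1) m, koszulD k v = z.1 := by
  rw [Submodule.Quotient.mk_eq_zero]
  rfl

variable {𝓜 : PolyGrading (k := k) w M} {b : ℕ} {s : Fin b → G}
  {φ : (Fin b → MvPolynomial (Fin n) k) →ₗ[MvPolynomial (Fin n) k] M}

theorem map_mem_koszulChain (hφ : ∀ a, φ (Pi.single a 1) ∈ 𝓜.piece (s a)) {j : ℕ} {m : G}
    {u : Finset (Fin n) → Fin b → MvPolynomial (Fin n) k}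
    (hu : u ∈ koszulChain (freeGrading w s) j m) :
    (fun S => φ (u S)) ∈ koszulChain 𝓜 j m :=
  fun S => ⟨map_mem_piece 𝓜 hφ (hu S).1, fun h => (congrArg φ ((hu S).2 h)).trans (map_zero φ)⟩

theorem exists_koszulChain_lift (hφ : ∀ a, φ (Pi.single a 1) ∈ 𝓜.piece (s a))
    (hsurj : Function.Surjective φ) {j : ℕ} {m : G} {y : Finset (Fin n) → M}
    (hy : y ∈ koszulChain 𝓜 j m) :
    ∃ u ∈ koszulChain (freeGrading w s) j m, (fun S => φ (u S)) = y := by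
  have : ∀ S, ∃ v ∈ (freeGrading (k := k) w s).piece (m - ∑ t ∈ S, w t),
      (S.card ≠ j → v = 0) ∧ φ v = y S := by
    intro S
    by_cases h : S.card = j
    · obtain ⟨v, hv, hv'⟩ := exists_mem_piece_of_surjective 𝓜 hφ hsurj (hy S).1
      exact ⟨v, hv, fun h' => absurd h h', hv'⟩
    · exact ⟨0, zero_mem _, fun _ => rfl, by rw [map_zero, (hy S).2 h]⟩
  choose u hu hu0 hφu using this
  exact ⟨u, fun S => ⟨hu S, hu0 S⟩, funext hφu⟩

/-- Dimension shifting. For a graded free cover `φ : F → M` with kernel `K` contained in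
`(x₁, …, x_n) F`, consider the Koszul chains `u` of `F` in degree `j + 1` with `φ (d u) = 0`. Then
`u ↦ φ u` maps them onto the Koszul cycles of `M` in degree `j + 1`, and `u ↦ d u` onto the Koszul
cycles of `K` in degree `j`; by exactness of the Koszul complex of `F`, the same `u` become
boundaries on either side. -/
theorem koszulHomology_succ_equiv (hφ : ∀ a, φ (Pi.single a 1) ∈ 𝓜.piece (s a))
    (hsurj : Function.Surjective φ) (hmin : ∀ u, φ u = 0 → ∀ a, coeff 0 (u a) = 0)
    (j : ℕ) (m : G) :
    Nonempty (KoszulHomology 𝓜 (j + 1) m ≃ₗ[k]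
      KoszulHomology ((freeGrading w s).ker 𝓜 φ (map_freeGrading_proj 𝓜 φ hφ)) j m) := by
  set 𝓚 := (freeGrading w s).ker 𝓜 φ (map_freeGrading_proj 𝓜 φ hφ)
  let W : Submodule k (Finset (Fin n) → Fin b → MvPolynomial (Fin n) k) :=
    koszulChain (freeGrading w s) (j + 1) m ⊓
      LinearMap.ker ((φ.restrictScalars k).compLeft (Finset (Fin n)) ∘ₗ koszulD k)
  have hW : ∀ u ∈ W, ∀ S, φ (koszulD k u S) = 0 := fun u hu S =>
    congrFun (LinearMap.mem_ker.1 hu.2) S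
  have hsub : ∀ v : Finset (Fin n) → LinearMap.ker φ, koszulD k (fun S => (v S).1)
      = fun S => (koszulD k v S).1 := koszulD_comp_map (LinearMap.ker φ).subtype
  let f : W →ₗ[k] koszulCycles 𝓜 (j + 1) m :=
    LinearMap.codRestrict _ ((φ.restrictScalars k).compLeft (Finset (Fin n)) ∘ₗ W.subtype)
      fun u => ⟨(koszulD_comp_map φ u.1).trans (funext (hW u.1 u.2)),
        map_mem_koszulChain hφ u.2.1⟩
  have hf : ∀ u, (f u).1 = fun S => φ (u.1 S) := fun _ => rfl
  let g : W →ₗ[k] koszulCycles 𝓚 j m :=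
    { toFun := fun u => ⟨fun S => ⟨koszulD k u.1 S, hW u.1 u.2 S⟩, by
        refine ⟨funext fun S => Subtype.ext ?_, fun S => ⟨?_, fun hS => Subtype.ext ?_⟩⟩
        · rw [← congrFun (hsub _) S, koszulD_koszulD]
          rfl
        · exact (koszulD_mem_koszulChain u.2.1 S).1
        · exact (koszulD_mem_koszulChain u.2.1 S).2 hS⟩
      map_add' := fun u v => Subtype.ext (funext fun S => Subtype.ext
        (congrFun (map_add (koszulD k) u.1 v.1) S))
      map_smul' := fun c u => Subtype.ext (funext fun S => Subtype.ext
        (congrFun (map_smul (koszulD k) c u.1) S)) }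
  have hg : ∀ u S, ((g u).1 S).1 = koszulD k u.1 S := fun _ _ => rfl
  refine nonempty_linearEquiv_of_ker_eq (Submodule.mkQ _ ∘ₗ f) (Submodule.mkQ _ ∘ₗ g)
    ((Submodule.mkQ_surjective _).comp ?_) ((Submodule.mkQ_surjective _).comp ?_) fun u => ?_
  · rintro ⟨z, hz⟩
    obtain ⟨u, hu, rfl⟩ := exists_koszulChain_lift hφ hsurj hz.2
    exact ⟨⟨u, hu, (koszulD_comp_map φ u).symm.trans hz.1⟩, rfl⟩
  · rintro ⟨z, hz⟩
    have hz' : (fun S => (z S).1) ∈ koszulCycles (freeGrading w s) j m := by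
      refine ⟨?_, fun S => ⟨(hz.2 S).1, fun hS => congrArg Subtype.val ((hz.2 S).2 hS)⟩⟩
      refine (hsub z).trans ?_
      rw [LinearMap.mem_ker.1 hz.1]
      rfl
    obtain ⟨u, hu, hdu⟩ := exists_koszulD_eq hz' (hmin _ (z ∅).2)
    refine ⟨⟨u, hu, funext fun S => ?_⟩, Subtype.ext (funext fun S => Subtype.ext ?_)⟩
    · change φ (koszulD k u S) = 0
      rw [hdu]
      exact (z S).2
    · rw [hg]
      exact congrFun hdu S
  · change (Submodule.Quotient.mk (f u) : KoszulHomology 𝓜 (j + 1) m) = 0 ↔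
      (Submodule.Quotient.mk (g u) : KoszulHomology 𝓚 j m) = 0
    rw [mkQ_koszulCycles_eq_zero_iff, mkQ_koszulCycles_eq_zero_iff]
    constructor
    · -- if `φ u = d (φ v)`, then `u - d v` is a chain of `K` with boundary `d u`
      rintro ⟨y, hy, hyu⟩
      obtain ⟨v, hv, rfl⟩ := exists_koszulChain_lift hφ hsurj hy
      have hdiff : ∀ S, φ (u.1 S - koszulD k v S) = 0 := fun S => by
        rw [map_sub, ← congrFun (koszulD_comp_map φ v) S, hyu, hf, sub_self]
      have hchain := sub_mem u.2.1 (koszulD_mem_koszulChain hv)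
      refine ⟨fun S => ⟨u.1 S - koszulD k v S, hdiff S⟩,
        fun S => ⟨(hchain S).1, fun hS => Subtype.ext ((hchain S).2 hS)⟩,
        funext fun S => Subtype.ext ?_⟩
      rw [hg, ← congrFun (hsub _) S]
      change koszulD k (u.1 - koszulD k v) S = _
      rw [map_sub, koszulD_koszulD, sub_zero]
    · -- if `d u = d κ` with `κ` a chain of `K`, then `u - κ` is a boundary `d v`, and `φ κ = 0`
      rintro ⟨κ, hκ, hκu⟩
      have hdiff : u.1 - (fun S => (κ S).1) ∈ koszulCycles (freeGrading w s) (j + 1) m := by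
        refine ⟨?_, sub_mem u.2.1
          fun S => ⟨(hκ S).1, fun hS => congrArg Subtype.val ((hκ S).2 hS)⟩⟩
        change koszulD k (u.1 - _) = 0
        rw [map_sub, hsub, hκu]
        exact sub_self _
      obtain ⟨v, hv, hvu⟩ := exists_koszulD_eq hdiff fun a => by
        rw [(hdiff.2 ∅).2 (by simp)]
        rfl
      refine ⟨fun S => φ (v S), map_mem_koszulChain hφ hv, ?_⟩
      rw [koszulD_comp_map, hvu, hf]
      funext S
      rw [Pi.sub_apply, map_sub, LinearMap.mem_ker.1 (κ S).2, sub_zero]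

theorem single_empty_mem_koszulCycles (𝓜 : PolyGrading (k := k) w M) {m : G} {y : M}
    (hy : y ∈ 𝓜.piece m) : (Pi.single ∅ y : Finset (Fin n) → M) ∈ koszulCycles 𝓜 0 m := by
  refine ⟨funext fun T => Finset.sum_eq_zero fun i _ => ?_, fun S => ?_⟩
  · rw [Pi.single_eq_of_ne (Finset.insert_ne_empty i T), smul_zero, smul_zero]
  · by_cases hS : S = ∅
    · subst hS
      rw [Pi.single_eq_same, Finset.sum_empty, sub_zero]
      exact ⟨hy, fun h => absurd rfl h⟩
    · rw [Pi.single_eq_of_ne hS]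
      exact ⟨zero_mem _, fun _ => rfl⟩

/-- The minimal generators of degree `m` span `M_m` modulo `∑ i, x_i M_{m - w i}`, freely because
all relations between them have coefficients in `(x₁, …, x_n)`. -/
theorem koszulHomology_zero_equiv (hφ : ∀ a, φ (Pi.single a 1) ∈ 𝓜.piece (s a))
    (hsurj : Function.Surjective φ) (hmin : ∀ u, φ u = 0 → ∀ a, coeff 0 (u a) = 0) (m : G) :
    Nonempty (KoszulHomology 𝓜 0 m ≃ₗ[k] ({a // s a = m} → k)) := by
  classical
  let W := (freeGrading (k := k) w s).piece m
  let f : W →ₗ[k] koszulCycles 𝓜 0 m :=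
    LinearMap.codRestrict _ (LinearMap.single k (fun _ : Finset (Fin n) => M) ∅ ∘ₗ
      φ.restrictScalars k ∘ₗ W.subtype)
      fun u => single_empty_mem_koszulCycles 𝓜 (map_mem_piece 𝓜 hφ u.2)
  have hf : ∀ u, (f u).1 = Pi.single ∅ (φ u.1) := fun _ => rfl
  let g : W →ₗ[k] ({a // s a = m} → k) := LinearMap.pi fun a =>
    lcoeff k 0 ∘ₗ LinearMap.proj a.1 ∘ₗ W.subtype
  have hg : ∀ u a, g u a = coeff 0 (u.1 a.1) := fun _ _ => rfl
  refine nonempty_linearEquiv_of_ker_eq (Submodule.mkQ _ ∘ₗ f) g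
    ((Submodule.mkQ_surjective _).comp ?_) (fun c => ?_) fun u => ?_
  · rintro ⟨z, hz⟩
    have h0 := (hz.2 ∅).1
    rw [Finset.sum_empty, sub_zero] at h0
    obtain ⟨u, hu, huz⟩ := exists_mem_piece_of_surjective 𝓜 hφ hsurj h0
    refine ⟨⟨u, hu⟩, Subtype.ext (funext fun S => ?_)⟩
    rw [hf]
    by_cases hS : S = ∅
    · subst hS
      rw [Pi.single_eq_same, huz]
    · rw [Pi.single_eq_of_ne hS]
      exact ((hz.2 S).2 (by simpa using hS)).symm
  · refine ⟨⟨fun a => if h : s a = m then C (c ⟨a, h⟩) else 0, fun a => ?_⟩, funext fun a => ?_⟩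
    · dsimp only
      split_ifs with h
      · rw [h, sub_self]
        exact isWeightedHomogeneous_C w _
      · exact isWeightedHomogeneous_zero _ _ _
    · rw [hg]
      simp only [a.2, dif_pos, coeff_zero_C]
  · change (Submodule.Quotient.mk (f u) : KoszulHomology 𝓜 0 m) = 0 ↔ _
    rw [mkQ_koszulCycles_eq_zero_iff, hf]
    constructor
    · rintro ⟨y, hy, hyu⟩
      obtain ⟨v, hv, rfl⟩ := exists_koszulChain_lift hφ hsurj hy
      have h1 : φ (u.1 - koszulD k v ∅) = 0 := by
        rw [map_sub, ← congrFun (koszulD_comp_map φ v) ∅, hyu, Pi.single_eq_same, sub_self]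
      funext a
      have h2 := hmin _ h1 a
      rw [Pi.sub_apply, coeff_sub, sub_eq_zero] at h2
      rw [hg, h2, koszulD_apply, Finset.sum_apply, coeff_sum]
      refine Finset.sum_eq_zero fun i _ => ?_
      rw [Pi.smul_apply, Pi.smul_apply, koszulSign_of_le (by simp), one_smul, smul_eq_mul,
        coeff_X_mul', if_neg (by simp)]
    · intro hu0
      have hcoeff : ∀ a, coeff 0 (u.1 a) = 0 := by
        intro a
        by_contra hne
        have := u.2 a hne
        rw [map_zero, eq_comm, sub_eq_zero] at this
        exact hne (congrFun hu0 ⟨a, this.symm⟩)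
      obtain ⟨v, hv, hvu⟩ := exists_koszulD_eq
        (single_empty_mem_koszulCycles (freeGrading w s) u.2) fun a => by
          rw [Pi.single_eq_same]
          exact hcoeff a
      refine ⟨fun S => φ (v S), map_mem_koszulChain hφ hv, ?_⟩
      rw [koszulD_comp_map, hvu]
      funext S
      by_cases hS : S = ∅
      · subst hS
        rw [Pi.single_eq_same, Pi.single_eq_same]
      · rw [Pi.single_eq_of_ne hS, Pi.single_eq_of_ne hS, map_zero]

end Betti

section Resolution

variable {k : Type u} [Field k] {n : ℕ} {G : Type*} [AddCommGroup G] {w : Fin n → G}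

section Tail

variable {M : Type*} [AddCommGroup M] [Module k M] [Module (MvPolynomial (Fin n) k) M]
  {𝓜 : PolyGrading (k := k) w M}

theorem MinimalGradedFreeResolution.coeff_zero_of_aug_eq_zero
    (F : MinimalGradedFreeResolution k w M fun g => (𝓜.piece g).toAddSubgroup)
    {u : Fin (F.rank 0) → MvPolynomial (Fin n) k} (hu : F.aug u = 0) (a : Fin (F.rank 0)) :
    coeff 0 (u a) = 0 := by
  have : u ∈ LinearMap.range (F.d 0) := by rwa [F.exact_zero]
  obtain ⟨v, rfl⟩ := this
  rw [← mem_span_range_X_iff]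
  have : F.d 0 v = ∑ c, v c • F.d 0 (Pi.single c 1) := by
    conv_lhs => rw [← Finset.univ_sum_single v, map_sum]
    refine Finset.sum_congr rfl fun c _ => ?_
    rw [← map_smul, ← Pi.single_smul, smul_eq_mul, mul_one]
  rw [this, Finset.sum_apply]
  exact sum_mem fun c _ => Ideal.mul_mem_left _ _ (F.minimal 0 c a)

variable [IsScalarTower k (MvPolynomial (Fin n) k) M]

/-- The grading of the first syzygy module of a resolution. -/
noncomputable def MinimalGradedFreeResolution.syzygyGrading
    (F : MinimalGradedFreeResolution k w M fun g => (𝓜.piece g).toAddSubgroup) :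
    PolyGrading (k := k) w (LinearMap.ker F.aug) :=
  (freeGrading w (F.shift 0)).ker 𝓜 F.aug (map_freeGrading_proj 𝓜 F.aug F.aug_homogeneous)

/-- A minimal resolution of `M`, without its module `F₀`, resolves the first syzygy module. -/
noncomputable def MinimalGradedFreeResolution.tail
    (F : MinimalGradedFreeResolution k w M fun g => (𝓜.piece g).toAddSubgroup) :
    MinimalGradedFreeResolution k w (LinearMap.ker F.aug)
      fun g => (F.syzygyGrading.piece g).toAddSubgroup where
  rank i := F.rank (i + 1)
  shift i := F.shift (i + 1)
  aug := (F.d 0).codRestrict _ fun u => F.exact_zero ▸ LinearMap.mem_range_self (F.d 0) u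
  d i := F.d (i + 1)
  aug_homogeneous a c := F.d_homogeneous 0 a c
  d_homogeneous i := F.d_homogeneous (i + 1)
  aug_surjective := by
    rintro ⟨y, hy⟩
    rw [← F.exact_zero] at hy
    obtain ⟨u, rfl⟩ := hy
    exact ⟨u, rfl⟩
  exact_zero := by
    rw [LinearMap.ker_codRestrict]
    exact F.exact_succ 0
  exact_succ i := F.exact_succ (i + 1)
  minimal i := F.minimal (i + 1)

end Tail

/-- Both sides of the equality of a Betti number and the dimension of a Koszul homology group shift
in the same way on passing to the first syzygy module. -/
theorem MinimalGradedFreeResolution.nonempty_koszulHomology_equiv (i : ℕ) (m : G) :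
    ∀ {M : Type u} [AddCommGroup M] [Module k M] [Module (MvPolynomial (Fin n) k) M]
      [IsScalarTower k (MvPolynomial (Fin n) k) M] {𝓜 : PolyGrading (k := k) w M}
      (F : MinimalGradedFreeResolution k w M fun g => (𝓜.piece g).toAddSubgroup),
      Nonempty (KoszulHomology 𝓜 i m ≃ₗ[k] ({a // F.shift i a = m} → k)) := by
  induction i with
  | zero =>
    intro M _ _ _ _ 𝓜 F
    exact koszulHomology_zero_equiv F.aug_homogeneous F.aug_surjective
      (fun u hu => F.coeff_zero_of_aug_eq_zero hu) m
  | succ i ih =>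
    intro M _ _ _ _ 𝓜 F
    obtain ⟨e⟩ := koszulHomology_succ_equiv F.aug_homogeneous F.aug_surjective
      (fun u hu => F.coeff_zero_of_aug_eq_zero hu) i m
    obtain ⟨e'⟩ := ih F.tail
    exact ⟨e ≪≫ₗ e'⟩

end Resolution

/-! ### Existence of minimal graded free resolutions -/

section Existence

variable {k : Type*} [Field k] {n : ℕ} {G : Type*} [AddCommGroup G] {w : Fin n → G}

/-- If no nonconstant monomial has degree `0`, then a nonzero polynomial of degree `0` is a nonzero
constant. -/
theorem eq_C_of_isWeightedHomogeneous_zero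
    (hw : ∀ e : Fin n →₀ ℕ, Finsupp.weight w e = 0 → e = 0) {f : MvPolynomial (Fin n) k}
    (hf : IsWeightedHomogeneous w f 0) : f = C (coeff 0 f) := by
  ext e
  rw [coeff_C]
  split_ifs with h
  · rw [h]
  · by_contra hne
    exact h (hw e (hf hne)).symm

/-- A homogeneous generating system of minimal cardinality has no relations with a coefficient
outside `(x₁, …, x_n)`: the homogeneous component of such a relation would express a generator
through the others. -/
theorem exists_minimal_generators
    (hw : ∀ e : Fin n →₀ ℕ, Finsupp.weight w e = 0 → e = 0)
    {N : Type*} [AddCommGroup N] [Module k N] [Module (MvPolynomial (Fin n) k) N]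
    [IsScalarTower k (MvPolynomial (Fin n) k) N] (𝓝 : PolyGrading (k := k) w N)
    (K : Submodule (MvPolynomial (Fin n) k) N)
    (hK : ∃ (b : ℕ) (v : Fin b → N) (s : Fin b → G), (∀ a, v a ∈ 𝓝.piece (s a)) ∧
      Submodule.span (MvPolynomial (Fin n) k) (Set.range v) = K) :
    ∃ (b : ℕ) (v : Fin b → N) (s : Fin b → G), (∀ a, v a ∈ 𝓝.piece (s a)) ∧
      Submodule.span (MvPolynomial (Fin n) k) (Set.range v) = K ∧
      ∀ u : Fin b → MvPolynomial (Fin n) k, ∑ a, u a • v a = 0 → ∀ a, coeff 0 (u a) = 0 := by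
  classical
  obtain ⟨v, s, hv, hspan⟩ := Nat.find_spec hK
  have hmin := fun b h => Nat.find_min hK (m := b) h
  generalize Nat.find hK = b at v s hv hspan hmin
  refine ⟨b, v, s, hv, hspan, fun u hu a₀ => ?_⟩
  by_contra hne
  obtain _ | b := b
  · exact a₀.elim0
  refine hmin b b.lt_succ_self ⟨v ∘ a₀.succAbove, s ∘ a₀.succAbove, fun a => hv _, ?_⟩
  -- the component of degree `s a₀` of the relation `u`
  have hrel := map_freeGrading_proj 𝓝 (Fintype.linearCombination (MvPolynomial (Fin n) k) v)
    (s := s) (fun a => by rw [Fintype.linearCombination_apply_single, one_smul]; exact hv a)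
    (s a₀) u
  rw [Fintype.linearCombination_apply, Fintype.linearCombination_apply, hu, map_zero] at hrel
  set u' := (freeGrading w s).proj (s a₀) u with hu'
  have hu'a₀ : u' a₀ = C (coeff 0 (u a₀)) := by
    have h1 : u' a₀ = weightedHomogeneousComponent w (s a₀ - s a₀) (u a₀) := rfl
    have h2 := weightedHomogeneousComponent_mem w (u a₀) (s a₀ - s a₀)
    rw [sub_self] at h1 h2
    rw [h1, eq_C_of_isWeightedHomogeneous_zero hw h2, coeff_weightedHomogeneousComponent,
      if_pos (map_zero _)]
  rw [← hspan]
  refine le_antisymm (Submodule.span_mono (Set.range_comp_subset_range _ _))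
    (Submodule.span_le.2 ?_)
  rintro _ ⟨a, rfl⟩
  rcases Fin.eq_self_or_eq_succAbove a₀ a with rfl | ⟨c, rfl⟩
  · rw [Fin.sum_univ_succAbove _ a, hu'a₀, add_eq_zero_iff_eq_neg] at hrel
    have h3 : v a = (C (coeff 0 (u a))⁻¹ : MvPolynomial (Fin n) k) •
        (C (coeff 0 (u a)) : MvPolynomial (Fin n) k) • v a := by
      rw [smul_smul, ← C_mul, inv_mul_cancel₀ hne, C_1, one_smul]
    rw [h3, hrel]
    exact Submodule.smul_mem _ _ (neg_mem (sum_mem fun c _ => Submodule.smul_mem _ _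
      (Submodule.subset_span ⟨c, rfl⟩)))
  · exact Submodule.subset_span ⟨c, rfl⟩

theorem exists_sum_freeGrading_proj {b : ℕ} (s : Fin b → G) (u : Fin b → MvPolynomial (Fin n) k) :
    ∃ T : Finset G, ∑ g ∈ T, (freeGrading w s).proj g u = u := by
  classical
  refine ⟨Finset.univ.biUnion fun a => (u a).support.image fun e => s a + Finsupp.weight w e,
    funext fun a => ?_⟩
  ext e
  have hcoeff : ∀ g, coeff e ((freeGrading w s).proj g u a)
      = if Finsupp.weight w e = g - s a then coeff e (u a) else 0 := fun g =>
    coeff_weightedHomogeneousComponent _ _ _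
  rw [Finset.sum_apply, coeff_sum, Finset.sum_congr rfl fun g _ => hcoeff g,
    Finset.sum_eq_single (s a + Finsupp.weight w e)]
  · rw [if_pos (add_sub_cancel_left _ _).symm]
  · intro g _ hg
    rw [if_neg]
    intro h
    rw [h, add_sub_cancel] at hg
    exact hg rfl
  · intro h
    rw [if_pos (add_sub_cancel_left _ _).symm]
    by_contra hne
    exact h (Finset.mem_biUnion.2 ⟨a, Finset.mem_univ _,
      Finset.mem_image_of_mem _ (mem_support_iff.2 hne)⟩)

theorem exists_homogeneous_generators {b : ℕ} (s : Fin b → G)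
    (K : Submodule (MvPolynomial (Fin n) k) (Fin b → MvPolynomial (Fin n) k))
    (hK : ∀ g, ∀ u ∈ K, (freeGrading w s).proj g u ∈ K) :
    ∃ (c : ℕ) (v : Fin c → Fin b → MvPolynomial (Fin n) k) (t : Fin c → G),
      (∀ a, v a ∈ (freeGrading w s).piece (t a)) ∧
      Submodule.span (MvPolynomial (Fin n) k) (Set.range v) = K := by
  let H : Set (Fin b → MvPolynomial (Fin n) k) := {u | u ∈ K ∧ ∃ g, u ∈ (freeGrading w s).piece g}
  have hH : Submodule.span (MvPolynomial (Fin n) k) H = K := by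
    refine le_antisymm (Submodule.span_le.2 fun u hu => hu.1) fun u hu => ?_
    obtain ⟨T, hT⟩ := exists_sum_freeGrading_proj (w := w) s u
    rw [← hT]
    exact sum_mem fun g _ => Submodule.subset_span ⟨hK g u hu, g,
      fun a => weightedHomogeneousComponent_mem w (u a) (g - s a)⟩
  obtain ⟨T, hTH, hT⟩ := (Submodule.fg_span_iff_fg_span_finset_subset H).1
    (IsNoetherian.noetherian (Submodule.span (MvPolynomial (Fin n) k) H))
  choose t ht using fun a : T => (hTH a.2).2
  refine ⟨T.card, fun a => (T.equivFin.symm a).1, fun a => t (T.equivFin.symm a), fun a => ht _, ?_⟩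
  have : Set.range (fun a => (T.equivFin.symm a).1) = T :=
    (T.equivFin.symm.surjective.range_comp Subtype.val).trans Subtype.range_val
  rw [this, ← hT, hH]

variable (k w) in
/-- A graded submodule of `(x₁, …, x_n) F` for a graded free module `F`: the state reached after
constructing a minimal resolution up to `F`, the submodule being the kernel to be covered next. -/
structure MinimalSyzygy where
  /-- the rank of the ambient free module -/
  rank : ℕ
  /-- the degrees of its basis vectors -/
  shift : Fin rank → G
  /-- the submodule -/
  syz : Submodule (MvPolynomial (Fin n) k) (Fin rank → MvPolynomial (Fin n) k)
  proj_mem : ∀ g, ∀ u ∈ syz, (freeGrading w shift).proj g u ∈ syz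
  coeff_zero : ∀ u ∈ syz, ∀ a, coeff 0 (u a) = 0

/-- A minimal free cover of a submodule with homogeneous generators, together with its kernel. -/
theorem exists_minimal_cover
    (hw : ∀ e : Fin n →₀ ℕ, Finsupp.weight w e = 0 → e = 0)
    {N : Type*} [AddCommGroup N] [Module k N] [Module (MvPolynomial (Fin n) k) N]
    [IsScalarTower k (MvPolynomial (Fin n) k) N] (𝓝 : PolyGrading (k := k) w N)
    (K : Submodule (MvPolynomial (Fin n) k) N)
    (hK : ∃ (b : ℕ) (v : Fin b → N) (s : Fin b → G), (∀ a, v a ∈ 𝓝.piece (s a)) ∧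
      Submodule.span (MvPolynomial (Fin n) k) (Set.range v) = K) :
    ∃ (Z : MinimalSyzygy k w)
      (φ : (Fin Z.rank → MvPolynomial (Fin n) k) →ₗ[MvPolynomial (Fin n) k] N),
      (∀ a, φ (Pi.single a 1) ∈ 𝓝.piece (Z.shift a)) ∧ LinearMap.range φ = K ∧
      LinearMap.ker φ = Z.syz := by
  obtain ⟨b, v, s, hv, hspan, hmin⟩ := exists_minimal_generators hw 𝓝 K hK
  have hφ : ∀ a, Fintype.linearCombination (MvPolynomial (Fin n) k) v (Pi.single a 1)
      ∈ 𝓝.piece (s a) := fun a => by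
    rw [Fintype.linearCombination_apply_single, one_smul]
    exact hv a
  refine ⟨⟨b, s, LinearMap.ker (Fintype.linearCombination (MvPolynomial (Fin n) k) v),
    fun g u hu => ?_, fun u hu => hmin u hu⟩, _, hφ,
    (Fintype.range_linearCombination _ v).trans hspan, rfl⟩
  rw [LinearMap.mem_ker, map_freeGrading_proj 𝓝 _ hφ, LinearMap.mem_ker.1 hu, map_zero]

/-- A graded module with finitely many homogeneous generators has a minimal graded free resolution
if no nonconstant monomial has degree `0`. -/
theorem nonempty_minimalGradedFreeResolution
    (hw : ∀ e : Fin n →₀ ℕ, Finsupp.weight w e = 0 → e = 0)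
    {M : Type*} [AddCommGroup M] [Module k M] [Module (MvPolynomial (Fin n) k) M]
    [IsScalarTower k (MvPolynomial (Fin n) k) M] (𝓜 : PolyGrading (k := k) w M)
    (hM : ∃ (b : ℕ) (v : Fin b → M) (s : Fin b → G), (∀ a, v a ∈ 𝓜.piece (s a)) ∧
      Submodule.span (MvPolynomial (Fin n) k) (Set.range v) = ⊤) :
    Nonempty (MinimalGradedFreeResolution k w M fun g => (𝓜.piece g).toAddSubgroup) := by
  obtain ⟨Z₀, aug, haug, haug_range, haug_ker⟩ := exists_minimal_cover hw 𝓜 ⊤ hM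
  choose next φ hφ hrange hker using fun Z : MinimalSyzygy k w =>
    exists_minimal_cover hw (freeGrading w Z.shift) Z.syz
      (exists_homogeneous_generators Z.shift Z.syz Z.proj_mem)
  let Z : ℕ → MinimalSyzygy k w := fun i => Nat.rec Z₀ (fun _ => next) i
  exact ⟨{
    rank := fun i => (Z i).rank
    shift := fun i => (Z i).shift
    aug := aug
    d := fun i => φ (Z i)
    aug_homogeneous := haug
    d_homogeneous := fun i => hφ (Z i)
    aug_surjective := LinearMap.range_eq_top.1 haug_range
    exact_zero := (hrange Z₀).trans haug_ker.symm
    exact_succ := fun i => (hrange (Z (i + 1))).trans (hker (Z i)).symm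
    minimal := fun i a b => mem_span_range_X_iff.2 ((Z i).coeff_zero _
      ((hrange (Z i)).le (LinearMap.mem_range_self _ _)) b) }⟩

end Existence

/-! ### The Koszul complex of the Cox ring -/

section Comparison

variable {k : Type u} [Field k] {X : Scheme.{u}} [X.Over (Spec (.of k))] [IsIntegral X]
variable {r : ℕ} {D : Fin r → Divisor k X} {n : ℕ} (P : CoxPresentation D n)

noncomputable instance : Module k P.Mod := inferInstanceAs (Module k (CoxRing D))

theorem CoxPresentation.smul_eq_toCox_mul (p : MvPolynomial (Fin n) k) (y : P.Mod) :
    p • y = (show P.Mod from P.toCox p * (show CoxRing D from y)) := rfl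

instance : IsScalarTower k (MvPolynomial (Fin n) k) P.Mod where
  smul_assoc c p y := by
    rw [P.smul_eq_toCox_mul, P.smul_eq_toCox_mul, map_smul]
    exact smul_mul_assoc c (P.toCox p) (show CoxRing D from y)

/-- The inclusion of a homogeneous part of the Cox ring. -/
noncomputable def CoxPresentation.incl (g : Fin r → ℤ) : coxPiece D g →ₗ[k] P.Mod :=
  DirectSum.lof k (Fin r → ℤ) (fun m => coxPiece D m) g

theorem CoxPresentation.incl_injective (g : Fin r → ℤ) : Function.Injective (P.incl g) :=
  DirectSum.of_injective g

theorem CoxPresentation.incl_congr {g h : Fin r → ℤ} (e : g = h) {y : coxPiece D g}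
    {z : coxPiece D h} (hyz : (y : RatFun k X) = z) : P.incl g y = P.incl h z := by
  subst e
  rw [Subtype.ext hyz]

theorem CoxPresentation.X_smul_incl (i : Fin n) {g : Fin r → ℤ} (y : coxPiece D g) :
    (MvPolynomial.X i : MvPolynomial (Fin n) k) • P.incl g y
      = P.incl (P.C i + g) ⟨P.x i * y, SetLike.mul_mem_graded (P.x i).2 y.2⟩ := by
  rw [P.smul_eq_toCox_mul, CoxPresentation.toCox, aeval_X]
  exact DirectSum.of_mul_of (A := fun m => coxPiece D m) (P.x i) y

/-- The grading of the Cox ring. -/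
noncomputable def CoxPresentation.grading : PolyGrading (k := k) P.C P.Mod where
  piece g := LinearMap.range (P.incl g)
  proj g := P.incl g ∘ₗ DirectSum.component k (Fin r → ℤ) (fun m => coxPiece D m) g
  proj_of_mem := by
    rintro g _ ⟨y, rfl⟩
    exact congrArg (P.incl g)
      (DirectSum.component.lof_self (R := k) (M := fun m => coxPiece D m) g y)
  proj_of_mem_ne := by
    rintro g h _ ⟨y, rfl⟩ hne
    refine (congrArg (P.incl g) ?_).trans (map_zero _)
    exact DirectSum.of_eq_of_ne (β := fun m => coxPiece D m) h g y hne.symm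
  X_smul_mem := by
    rintro g _ i ⟨y, rfl⟩
    rw [P.X_smul_incl, add_comm g]
    exact ⟨_, rfl⟩

theorem CoxPresentation.modPiece_eq :
    P.modPiece = fun g => (P.grading.piece g).toAddSubgroup := by
  funext g
  ext y
  exact Iff.rfl

/-- The Cox ring is generated by `1` as a module over the polynomial ring. -/
theorem CoxPresentation.exists_generators :
    ∃ (b : ℕ) (v : Fin b → P.Mod) (s : Fin b → Fin r → ℤ), (∀ a, v a ∈ P.grading.piece (s a)) ∧
      Submodule.span (MvPolynomial (Fin n) k) (Set.range v) = ⊤ := by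
  refine ⟨1, fun _ => (show P.Mod from (1 : CoxRing D)), fun _ => 0, fun _ => ?_, ?_⟩
  · have h1 : (1 : RatFun k X) ∈ coxPiece D 0 := SetLike.GradedOne.one_mem
    exact ⟨⟨1, h1⟩, rfl⟩
  rw [eq_top_iff]
  intro y _
  obtain ⟨p, hp⟩ := P.surjective y
  have : y = p • (show P.Mod from (1 : CoxRing D)) := by
    rw [P.smul_eq_toCox_mul]
    exact (hp.symm.trans (mul_one _).symm)
  rw [this]
  exact Submodule.smul_mem _ _ (Submodule.subset_span ⟨0, rfl⟩)

variable (m : Fin r → ℤ)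

theorem incl_mulGen (S : Finset (Fin n)) (i : Fin n) (hi : i ∈ S)
    (y : coxPiece D (m - ∑ t ∈ S, P.C t)) :
    P.incl _ (mulGen P m S i hi y) = (MvPolynomial.X i : MvPolynomial (Fin n) k) • P.incl _ y := by
  rw [P.X_smul_incl]
  refine P.incl_congr ?_ rfl
  rw [← Finset.add_sum_erase S P.C hi]
  abel

/-- The identification of `𝔸_j` with the Koszul chains of the Cox ring of degree `(j, m)`. -/
noncomputable def toKoszul (j : ℕ) : A P m j →ₗ[k] (Finset (Fin n) → P.Mod) :=
  LinearMap.pi fun S => if h : S.card = j then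
    P.incl (m - ∑ t ∈ S, P.C t) ∘ₗ DirectSum.component k {S : Finset (Fin n) // S.card = j}
      (fun S => coxPiece D (m - ∑ t ∈ S.1, P.C t)) ⟨S, h⟩
    else 0

theorem toKoszul_apply {j : ℕ} (u : A P m j) (S : {S : Finset (Fin n) // S.card = j}) :
    toKoszul P m j u S.1 = P.incl _ (u S) := by
  rw [toKoszul, LinearMap.pi_apply, dif_pos S.2]
  rfl

theorem toKoszul_apply_of_ne {j : ℕ} (u : A P m j) {S : Finset (Fin n)} (h : S.card ≠ j) :
    toKoszul P m j u S = 0 := by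
  rw [toKoszul, LinearMap.pi_apply, dif_neg h]
  rfl

theorem toKoszul_injective (j : ℕ) : Function.Injective (toKoszul P m j) := by
  intro u v h
  refine DFinsupp.ext fun S => P.incl_injective _ ?_
  rw [← toKoszul_apply, ← toKoszul_apply, h]

theorem toKoszul_mem {j : ℕ} (u : A P m j) : toKoszul P m j u ∈ koszulChain P.grading j m := by
  refine fun S => ⟨?_, toKoszul_apply_of_ne P m u⟩
  by_cases h : S.card = j
  · rw [toKoszul_apply P m u ⟨S, h⟩]
    exact ⟨_, rfl⟩
  · rw [toKoszul_apply_of_ne P m u h]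
    exact zero_mem _

theorem exists_toKoszul_eq {j : ℕ} {y : Finset (Fin n) → P.Mod}
    (hy : y ∈ koszulChain P.grading j m) : ∃ u, toKoszul P m j u = y := by
  choose u hu using fun S => (hy S).1
  refine ⟨(DirectSum.linearEquivFunOnFintype k {S : Finset (Fin n) // S.card = j}
    (fun S => coxPiece D (m - ∑ t ∈ S.1, P.C t))).symm fun S => u S.1, funext fun S => ?_⟩
  by_cases h : S.card = j
  · rw [toKoszul_apply P m _ ⟨S, h⟩, ← hu S]
    rfl
  · rw [toKoszul_apply_of_ne P m _ h, (hy S).2 h]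

theorem toKoszul_lof {j : ℕ} (S : {S : Finset (Fin n) // S.card = j})
    (y : coxPiece D (m - ∑ t ∈ S.1, P.C t)) :
    toKoszul P m j (DirectSum.lof k {S : Finset (Fin n) // S.card = j}
      (fun S => coxPiece D (m - ∑ t ∈ S.1, P.C t)) S y) = Pi.single S.1 (P.incl _ y) := by
  funext T
  by_cases hT : T = S.1
  · subst hT
    rw [Pi.single_eq_same, toKoszul_apply, DirectSum.lof_apply]
  · rw [Pi.single_eq_of_ne hT]
    by_cases h : T.card = j
    · have hne : (⟨T, h⟩ : {S : Finset (Fin n) // S.card = j}) ≠ S :=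
        fun e => hT (congrArg Subtype.val e)
      rw [toKoszul_apply P m _ ⟨T, h⟩]
      refine (congrArg (P.incl _) ?_).trans (map_zero _)
      exact DirectSum.of_eq_of_ne (β := fun S : {S : Finset (Fin n) // S.card = j} =>
        coxPiece D (m - ∑ t ∈ S.1, P.C t)) S ⟨T, h⟩ y hne
    · rw [toKoszul_apply_of_ne P m _ h]

theorem toKoszul_dA (j : ℕ) (u : A P m (j + 1)) :
    toKoszul P m j (dA P m j u) = koszulD k (toKoszul P m (j + 1) u) := by
  suffices h : toKoszul P m j ∘ₗ dA P m j = koszulD k ∘ₗ toKoszul P m (j + 1) from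
    LinearMap.congr_fun h u
  refine DirectSum.linearMap_ext k fun S => LinearMap.ext fun y => funext fun T => ?_
  rw [LinearMap.comp_apply, LinearMap.comp_apply, LinearMap.comp_apply, LinearMap.comp_apply,
    toKoszul_lof, dA, DirectSum.toModule_lof, LinearMap.sum_apply, map_sum, Finset.sum_apply,
    koszulD_apply]
  set Y := P.incl _ y with hY
  -- the contribution of the index `i` to either side
  let h : Fin n → P.Mod := fun i => if i ∉ T ∧ insert i T = S.1 then
    koszulSign i T • (MvPolynomial.X i : MvPolynomial (Fin n) k) • Y else 0
  have hl : ∀ i : {i // i ∈ S.1}, toKoszul P m j ((((-1 : k) ^ (S.1.filter (· < i.1)).card) •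
      (DirectSum.lof k {T : Finset (Fin n) // T.card = j}
          (fun T => coxPiece D (m - ∑ t ∈ T.1, P.C t))
          ⟨S.1.erase i.1, by rw [Finset.card_erase_of_mem i.2, S.2]; rfl⟩ ∘ₗ
        mulGen P m S.1 i.1 i.2)) y) T = h i.1 := by
    rintro ⟨i, hi⟩
    rw [LinearMap.smul_apply, map_smul, LinearMap.comp_apply, toKoszul_lof, Pi.smul_apply,
      incl_mulGen]
    by_cases hT : T = S.1.erase i
    · have h1 : i ∉ T ∧ insert i T = S.1 := by
        rw [hT]
        exact ⟨Finset.notMem_erase _ _, Finset.insert_erase hi⟩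
      have h2 : koszulSign i T = (-1) ^ (S.1.filter (· < i)).card := by
        rw [← koszulSign_insert_of_le (l := i) le_rfl, h1.2, koszulSign]
      simp only [h]
      rw [if_pos h1, h2, hT, Pi.single_eq_same, ← hY, ← Int.cast_smul_eq_zsmul k]
      push_cast
      rfl
    · rw [Pi.single_eq_of_ne hT, smul_zero]
      exact (if_neg fun h => hT (by rw [← h.2, Finset.erase_insert h.1])).symm
  rw [Finset.sum_congr rfl fun i _ => hl i, Finset.sum_coe_sort S.1 h]
  trans ∑ i, h i
  · refine Finset.sum_subset (Finset.subset_univ _) fun i _ hi => if_neg fun h' => hi ?_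
    rw [← h'.2]
    exact Finset.mem_insert_self i T
  · symm
    refine (Finset.sum_congr rfl fun i hi => ?_).trans
      (Finset.sum_subset (Finset.subset_univ Tᶜ) fun i _ hi => if_neg fun h' =>
        hi (Finset.mem_compl.2 h'.1))
    by_cases h' : insert i T = S.1
    · rw [h', Pi.single_eq_same]
      exact (if_pos (And.intro (Finset.mem_compl.1 hi) h')).symm
    · rw [Pi.single_eq_of_ne h', smul_zero, smul_zero]
      exact (if_neg fun h'' => h' h''.2).symm

theorem dA_comp_dA (j : ℕ) : dA P m j ∘ₗ dA P m (j + 1) = 0 := by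
  refine LinearMap.ext fun u => toKoszul_injective P m j ?_
  rw [LinearMap.comp_apply, toKoszul_dA, toKoszul_dA, koszulD_koszulD, LinearMap.zero_apply,
    map_zero]

theorem mem_cyclesA_iff : ∀ {i : ℕ} {u : A P m i},
    u ∈ cyclesA P m i ↔ koszulD k (toKoszul P m i u) = 0
  | 0, u => by
    refine iff_of_true trivial (funext fun T => Finset.sum_eq_zero fun i _ => ?_)
    rw [toKoszul_apply_of_ne P m u (by simp), smul_zero, smul_zero]
  | i + 1, u => by
    rw [← toKoszul_dA, ← map_zero (toKoszul P m i)]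
    exact (toKoszul_injective P m i).eq_iff.symm

theorem nonempty_homologyA_equiv (i : ℕ) :
    Nonempty (homologyA P m i ≃ₗ[k] KoszulHomology P.grading i m) := by
  let g : cyclesA P m i →ₗ[k] koszulCycles P.grading i m :=
    LinearMap.codRestrict _ (toKoszul P m i ∘ₗ (cyclesA P m i).subtype)
      fun u => ⟨(mem_cyclesA_iff P m).1 u.2, toKoszul_mem P m u.1⟩
  refine nonempty_linearEquiv_of_ker_eq (Submodule.mkQ _) (Submodule.mkQ _ ∘ₗ g)
    (Submodule.mkQ_surjective _) ((Submodule.mkQ_surjective _).comp ?_) fun u => ?_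
  · rintro ⟨z, hz⟩
    obtain ⟨u, rfl⟩ := exists_toKoszul_eq P m hz.2
    exact ⟨⟨u, (mem_cyclesA_iff P m).2 hz.1⟩, rfl⟩
  · rw [Submodule.mkQ_apply, Submodule.Quotient.mk_eq_zero]
    change u.1 ∈ LinearMap.range (dA P m i) ↔
      (Submodule.Quotient.mk (g u) : KoszulHomology P.grading i m) = 0
    rw [mkQ_koszulCycles_eq_zero_iff]
    constructor
    · rintro ⟨v, hv⟩
      refine ⟨toKoszul P m (i + 1) v, toKoszul_mem P m v, ?_⟩
      rw [← toKoszul_dA, hv]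
      rfl
    · rintro ⟨y, hy, hyu⟩
      obtain ⟨v, rfl⟩ := exists_toKoszul_eq P m hy
      rw [← toKoszul_dA] at hyu
      exact ⟨v, toKoszul_injective P m i hyu⟩

end Comparison

end CoxSyzygy

theorem mainTheorem3 {k : Type u} [Field k] {X : Scheme.{u}} [X.Over (Spec (.of k))]
    [IsIntegral X] [Smooth (X ↘ Spec (.of k))] (hX : CoxSyzygy.IsProjective k X)
    {r : ℕ} (D : Fin r → CoxSyzygy.Divisor k X) (hDeff : ∀ i, CoxSyzygy.IsEffective (D i))
    (hDbasis : CoxSyzygy.IsPicardBasis D)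
    {n : ℕ} (P : CoxSyzygy.CoxPresentation D n) :
    (∀ (m : Fin r → ℤ) (j : ℕ), CoxSyzygy.dA P m j ∘ₗ CoxSyzygy.dA P m (j + 1) = 0) ∧
    Nonempty (CoxSyzygy.MinimalGradedFreeResolution k P.C P.Mod P.modPiece) ∧
    ∀ (F : CoxSyzygy.MinimalGradedFreeResolution k P.C P.Mod P.modPiece) (i : ℕ) (m : Fin r → ℤ),
      Module.Finite k (CoxSyzygy.homologyA P m i) ∧
      F.betti i m = Module.finrank k (CoxSyzygy.homologyA P m i) := by
  refine ⟨fun m j => CoxSyzygy.dA_comp_dA P m j, ?_⟩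
  rw [P.modPiece_eq]
  refine ⟨CoxSyzygy.nonempty_minimalGradedFreeResolution (P.eq_zero_of_weight_eq_zero hX)
    P.grading P.exists_generators, fun F i m => ?_⟩
  obtain ⟨e⟩ := CoxSyzygy.nonempty_homologyA_equiv P m i
  obtain ⟨e'⟩ := F.nonempty_koszulHomology_equiv i m
  refine ⟨Module.Finite.equiv (e ≪≫ₗ e').symm, ?_⟩
  rw [(e ≪≫ₗ e').finrank_eq, Module.finrank_fintype_fun_eq_card, ← Nat.card_eq_fintype_card]
  rfl
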